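/- Let $i\colon Z\to Y$ be a strict closed immersion of fs log schemes (log structures being taken on the small étale site), that is, a morphism of log schemes whose underlying morphism of schemes $\underline{i}\colon\underline{Z}\to\underline{Y}$ is a closed immersion and for which the natural map from the pullback log structure $i^*\mathcal{M}_Y$ to $\mathcal{M}_Z$ is an isomorphism. Assume that the log structure of $Y$ is trivial on the open complement $Y-Z$, i.e. $\mathcal{M}_Y|_{Y-Z}=\mathcal{O}_{Y-Z}^\times$. Write $\mathcal{M}^{\mathrm{gp}}$ for the étale sheaf of abelian groups associated with the group completion of the sheaf of monoids $\mathcal{M}$, and $R\Gamma_{\mathrm{s\acute{e}t}}(Y,-)$ for derived global sections in the strict étale topology of the log scheme $Y$, i.e. on the small étale site of the underlying scheme $\underline{Y}$. Then the square $$ \begin{array}{ccc} R\Gamma_{\mathrm{\acute{e}t}}(\underline{Y},\mathcal{O}_{\underline{Y}}^\times) & \longrightarrow & R\Gamma_{\mathrm{\acute{e}t}}(\underline{Z},\mathcal{O}_{\underline{Z}}^\times)\\ \downarrow & & \downarrow\\ R\Gamma_{\mathrm{s\acute{e}t}}(Y,\mathcal{M}_Y^{\mathrm{gp}}) & \longrightarrow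 & R\Gamma_{\mathrm{s\acute{e}t}}(Z,\mathcal{M}_Z^{\mathrm{gp}}) \end{array} $$ whose horizontal maps are induced by the restriction maps $\mathcal{O}_{\underline{Y}}^\times\to \underline{i}_*\mathcal{O}_{\underline{Z}}^\times$ and $\mathcal{M}_Y^{\mathrm{gp}}\to \underline{i}_*\mathcal{M}_Z^{\mathrm{gp}}$, and whose vertical maps are induced by the inclusions $\mathcal{O}^\times\to\mathcal{M}^{\mathrm{gp}}$, is (homotopy) cartesian in the derived category of abelian groups: the induced map from the homotopy fibre of the top row to the homotopy fibre of the bottom row is a quasi-isomorphism. -/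

import Mathlib

open CategoryTheory CategoryTheory.Limits AlgebraicGeometry Opposite

universe u

noncomputable section

namespace LogGeometry

/-! ### The small étale site, base change and push-forward -/

section EtaleSite

variable {Y Z : Scheme.{u}}

/-- The underlying scheme of an object of the small étale site. -/
def esch (U : Y.Etale) : Scheme.{u} := ((Scheme.Etale.forget Y).obj U).left

/-- The structure morphism of an object of the small étale site. -/
def estr (U : Y.Etale) : esch U ⟶ Y := ((Scheme.Etale.forget Y).obj U).hom

/-- The morphism of schemes underlying a morphism of the small étale site. -/
def emap {U V : Y.Etale} (g : U ⟶ V) : esch U ⟶ esch V := ((Scheme.Etale.forget Y).map g).left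

instance (U : Y.Etale) : Etale (estr U) := U.prop

instance {U V : Y.Etale} (g : U ⟶ V) : Etale (emap g) :=
  inferInstanceAs (Etale g.left)

lemma emap_id (U : Y.Etale) : emap (𝟙 U) = 𝟙 (esch U) := rfl

lemma emap_comp {U V W : Y.Etale} (g : U ⟶ V) (h : V ⟶ W) :
    emap (g ≫ h) = emap g ≫ emap h := rfl

lemma emap_w {U V : Y.Etale} (g : U ⟶ V) : emap g ≫ estr V = estr U :=
  Over.w ((Scheme.Etale.forget Y).map g)

lemma ehom_ext {U V : Y.Etale} {g h : U ⟶ V} (e : emap g = emap h) : g = h :=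
  (Scheme.Etale.forget Y).map_injective (Over.OverMorphism.ext e)

/-- A morphism of étale `Y`-schemes from a morphism of schemes over `Y`. -/
def ehomMk {U V : Y.Etale} (g : esch U ⟶ esch V) (h : g ≫ estr V = estr U) : U ⟶ V :=
  (Scheme.Etale.forgetFullyFaithful Y).preimage (Over.homMk g h)

lemma emap_ehomMk {U V : Y.Etale} (g : esch U ⟶ esch V) (h : g ≫ estr V = estr U) :
    emap (ehomMk g h) = g := rfl

/-- The terminal object `Y = Y` of the small étale site of `Y`. -/
def etaleTop (Y : Scheme.{u}) : Y.Etale := Scheme.Etale.mk (𝟙 Y)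

/-- The morphism `U ×_Y Z ⟶ V ×_Y Z` induced by a morphism `U ⟶ V` over `Y`. -/
def baseChangeMap (f : Z ⟶ Y) {U V : Y.Etale} (g : U ⟶ V) :
    pullback (estr U) f ⟶ pullback (estr V) f :=
  pullback.lift (pullback.fst (estr U) f ≫ emap g) (pullback.snd (estr U) f)
    (by rw [Category.assoc, emap_w, pullback.condition])

lemma baseChangeMap_fst (f : Z ⟶ Y) {U V : Y.Etale} (g : U ⟶ V) :
    baseChangeMap f g ≫ pullback.fst (estr V) f = pullback.fst (estr U) f ≫ emap g :=
  pullback.lift_fst _ _ _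

lemma baseChangeMap_snd (f : Z ⟶ Y) {U V : Y.Etale} (g : U ⟶ V) :
    baseChangeMap f g ≫ pullback.snd (estr V) f = pullback.snd (estr U) f :=
  pullback.lift_snd _ _ _

/-- Base change `U ↦ U ×_Y Z` along `f : Z ⟶ Y`, from the small étale site of `Y` to that of `Z`. -/
def etalePullback (f : Z ⟶ Y) : Y.Etale ⥤ Z.Etale where
  obj U := Scheme.Etale.mk (pullback.snd (estr U) f)
  map g := ehomMk (baseChangeMap f g) (pullback.lift_snd _ _ _)
  map_id U := ehom_ext (show baseChangeMap f (𝟙 U) = 𝟙 (pullback (estr U) f) from by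
    apply pullback.hom_ext <;> simp [baseChangeMap, emap_id])
  map_comp {U V W} g h := ehom_ext
    (show baseChangeMap f (g ≫ h) = baseChangeMap f g ≫ baseChangeMap f h from by
      apply pullback.hom_ext
      · rw [baseChangeMap_fst, Category.assoc, baseChangeMap_fst, ← Category.assoc,
          baseChangeMap_fst, Category.assoc, emap_comp]
      · rw [baseChangeMap_snd, Category.assoc, baseChangeMap_snd, baseChangeMap_snd])

/-- The projection `U ×_Y Z ⟶ U`. -/
def etalePullbackFst (f : Z ⟶ Y) (U : Y.Etale) : esch ((etalePullback f).obj U) ⟶ esch U :=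
  pullback.fst (estr U) f

lemma etalePullback_map_fst (f : Z ⟶ Y) {U V : Y.Etale} (g : U ⟶ V) :
    emap ((etalePullback f).map g) ≫ etalePullbackFst f V = etalePullbackFst f U ≫ emap g :=
  pullback.lift_fst _ _ _

lemma etalePullback_isPullback (f : Z ⟶ Y) (U : Y.Etale) :
    IsPullback (etalePullbackFst f U) (estr ((etalePullback f).obj U)) (estr U) f :=
  IsPullback.of_hasPullback (estr U) f

lemma etalePullback_map_isPullback (f : Z ⟶ Y) {U V : Y.Etale} (g : U ⟶ V) :
    IsPullback (emap ((etalePullback f).map g)) (etalePullbackFst f U) (etalePullbackFst f V)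
      (emap g) := by
  refine IsPullback.of_right ?_ (etalePullback_map_fst f g) (etalePullback_isPullback f V).flip
  rw [emap_w, emap_w]
  exact (etalePullback_isPullback f U).flip

/-- The canonical morphism (in fact an isomorphism) `Z ⟶ Y ×_Y Z` of étale `Z`-schemes. -/
def etaleTopComparison (f : Z ⟶ Y) : etaleTop Z ⟶ (etalePullback f).obj (etaleTop Y) :=
  ehomMk (pullback.lift (f := 𝟙 Y) (g := f) f (𝟙 Z)
    ((Category.comp_id _).trans (Category.id_comp _).symm)) (pullback.lift_snd _ _ _)

lemma etalePullback_coverPreserving (f : Z ⟶ Y) :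
    CoverPreserving Y.smallEtaleTopology Z.smallEtaleTopology (etalePullback f) where
  cover_preserve {U S} hS := by
    obtain ⟨ι, V, g, rfl⟩ := S.exists_eq_ofArrows
    rw [Sieve.ofArrows, ← Sieve.generate_map_eq_functorPushforward, Presieve.map_ofArrows]
    rw [Scheme.ofArrows_mem_smallEtaleTopology_iff] at hS
    refine (Scheme.ofArrows_mem_smallEtaleTopology_iff _).2 ?_
    refine Set.eq_univ_of_forall fun (x : esch ((etalePullback f).obj U)) => ?_
    have hx : etalePullbackFst f U x ∈ ⋃ i, Set.range (emap (g i)) := by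
      change _ ∈ ⋃ i, Set.range (g i).left
      rw [hS]; trivial
    obtain ⟨i, v, hv⟩ := Set.mem_iUnion.1 hx
    obtain ⟨w, hw, -⟩ := Scheme.Pullback.exists_preimage_pullback x v hv.symm
    refine Set.mem_iUnion.2 ⟨i, (etalePullback_map_isPullback f (g i)).isoPullback.inv w, ?_⟩
    change emap ((etalePullback f).map (g i)) _ = _
    rw [← Scheme.Hom.comp_apply, IsPullback.isoPullback_inv_fst]
    exact hw

lemma etalePullback_exists_lift (f : Z ⟶ Y) {V₁ V₂ W : Y.Etale} (g₁ : V₁ ⟶ W) (g₂ : V₂ ⟶ W)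
    {X : Z.Etale} (f₁ : X ⟶ (etalePullback f).obj V₁) (f₂ : X ⟶ (etalePullback f).obj V₂)
    (e : f₁ ≫ (etalePullback f).map g₁ = f₂ ≫ (etalePullback f).map g₂) :
    ∃ (P : Y.Etale) (p₁ : P ⟶ V₁) (p₂ : P ⟶ V₂) (l : X ⟶ (etalePullback f).obj P),
      p₁ ≫ g₁ = p₂ ≫ g₂ ∧ l ≫ (etalePullback f).map p₁ = f₁ ∧
        l ≫ (etalePullback f).map p₂ = f₂ := by
  have he : (emap f₁ ≫ etalePullbackFst f V₁) ≫ emap g₁ =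
      (emap f₂ ≫ etalePullbackFst f V₂) ≫ emap g₂ := by
    rw [Category.assoc, Category.assoc, ← etalePullback_map_fst, ← etalePullback_map_fst,
      ← Category.assoc, ← Category.assoc, ← emap_comp, ← emap_comp, e]
  have hq : pullback.snd (emap g₁) (emap g₂) ≫ estr V₂ =
      pullback.fst (emap g₁) (emap g₂) ≫ estr V₁ := by
    rw [← emap_w g₁, ← emap_w g₂, ← Category.assoc, ← Category.assoc, pullback.condition]
  let P : Y.Etale := Scheme.Etale.mk (pullback.fst (emap g₁) (emap g₂) ≫ estr V₁)
  let p₁ : P ⟶ V₁ := ehomMk (pullback.fst (emap g₁) (emap g₂)) rfl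
  let p₂ : P ⟶ V₂ := ehomMk (pullback.snd (emap g₁) (emap g₂)) hq
  have hw : (emap f₁ ≫ etalePullbackFst f V₁) ≫ estr V₁ = estr X ≫ f := by
    rw [Category.assoc, (etalePullback_isPullback f V₁).w, ← Category.assoc, emap_w]
  let a : esch X ⟶ esch P := pullback.lift _ _ he
  have ha₁ : a ≫ emap p₁ = emap f₁ ≫ etalePullbackFst f V₁ := pullback.lift_fst _ _ _
  have ha₂ : a ≫ emap p₂ = emap f₂ ≫ etalePullbackFst f V₂ := pullback.lift_snd _ _ _
  have haP : a ≫ estr P = estr X ≫ f := by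
    rw [← emap_w p₁, ← Category.assoc, ha₁, hw]
  let b := (etalePullback_isPullback f P).lift a (estr X) haP
  have hb₁ : b ≫ etalePullbackFst f P = a := (etalePullback_isPullback f P).lift_fst _ _ _
  have hb₂ : b ≫ estr _ = estr X := (etalePullback_isPullback f P).lift_snd _ _ _
  refine ⟨P, p₁, p₂, ehomMk b hb₂, ?_, ?_, ?_⟩
  · exact ehom_ext pullback.condition
  · apply ehom_ext
    rw [emap_comp, emap_ehomMk]
    apply (etalePullback_isPullback f V₁).hom_ext
    · rw [Category.assoc, etalePullback_map_fst, ← Category.assoc, hb₁, ha₁]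
    · rw [Category.assoc, emap_w, emap_w, hb₂]
  · apply ehom_ext
    rw [emap_comp, emap_ehomMk]
    apply (etalePullback_isPullback f V₂).hom_ext
    · rw [Category.assoc, etalePullback_map_fst, ← Category.assoc, hb₁, ha₂]
    · rw [Category.assoc, emap_w, emap_w, hb₂]

lemma etalePullback_compatiblePreserving (f : Z ⟶ Y) :
    CompatiblePreserving.{u + 1} Z.smallEtaleTopology (etalePullback f) where
  compatible ℱ W T x hx V₁ V₂ X f₁ f₂ g₁ g₂ hg₁ hg₂ e := by
    obtain ⟨P, p₁, p₂, l, hp, rfl, rfl⟩ := etalePullback_exists_lift f g₁ g₂ f₁ f₂ e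
    have := hx p₁ p₂ hg₁ hg₂ hp
    simp only [Functor.comp_map, Functor.op_map, Quiver.Hom.unop_op] at this
    simp only [op_comp, Functor.map_comp, types_comp_apply]
    exact congrArg _ this

instance (f : Z ⟶ Y) :
    (etalePullback f).IsContinuous Y.smallEtaleTopology Z.smallEtaleTopology :=
  Functor.isContinuous_of_coverPreserving (etalePullback_compatiblePreserving f)
    (etalePullback_coverPreserving f)

/-- The push-forward `f_*` of étale sheaves of abelian groups, `(f_* F)(U) = F(U ×_Y Z)`. -/
def pushforward (f : Z ⟶ Y) :
    Sheaf Z.smallEtaleTopology AddCommGrpCat.{u} ⥤ Sheaf Y.smallEtaleTopology AddCommGrpCat.{u} :=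
  (etalePullback f).sheafPushforwardContinuous _ _ _

instance (f : Z ⟶ Y) : (pushforward f).Additive where
  map_add := rfl

/-- Global sections of étale sheaves of abelian groups. -/
def globalSections (Y : Scheme.{u}) :
    Sheaf Y.smallEtaleTopology AddCommGrpCat.{u} ⥤ AddCommGrpCat.{u} :=
  (sheafSections _ _).obj (op (etaleTop Y))

instance : (globalSections Y).Additive where
  map_add := rfl

/-- The canonical identification `Γ(Y, f_* F) = F(Y ×_Y Z) ⟶ F(Z) = Γ(Z, F)`. -/
def globalSectionsPushforward (f : Z ⟶ Y) :
    pushforward f ⋙ globalSections Y ⟶ globalSections Z where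
  app F := F.obj.map (etaleTopComparison f).op
  naturality _ _ φ := (φ.hom.naturality _).symm

end EtaleSite

/-! ### The structure sheaf, its units, and group completion -/

/-- The structure sheaf of the small étale site, with its multiplication only: `U ↦ (𝒪(U), ·)`. -/
def structMonoid (Y : Scheme.{u}) : Y.Etaleᵒᵖ ⥤ CommMonCat.{u} :=
  (Scheme.Etale.forget Y ⋙ Over.forget Y).op ⋙ Scheme.Γ ⋙ forget₂ CommRingCat CommMonCat

/-- The map `𝒪_Y ⟶ f_* 𝒪_Z`. -/
def structMap {Z Y : Scheme.{u}} (f : Z ⟶ Y) :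
    structMonoid Y ⟶ (etalePullback f).op ⋙ structMonoid Z where
  app U := (Scheme.Γ ⋙ forget₂ CommRingCat CommMonCat).map (etalePullbackFst f U.unop).op
  naturality U V g := by
    have := etalePullback_map_fst f g.unop
    have := congrArg (fun a => (Scheme.Γ ⋙ forget₂ CommRingCat CommMonCat).map a.op) this
    simp only [op_comp, Functor.map_comp] at this
    exact this.symm

/-- The homomorphism `M^gp → N^gp` induced by a homomorphism of monoids. -/
def gpMap {M N : Type*} [CommMonoid M] [CommMonoid N] (φ : M →* N) :
    Algebra.GrothendieckGroup M →* Algebra.GrothendieckGroup N :=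
  Algebra.GrothendieckGroup.lift (Algebra.GrothendieckGroup.of.comp φ)

lemma gpMap_comp_of {M N : Type*} [CommMonoid M] [CommMonoid N] (φ : M →* N) :
    (gpMap φ).comp Algebra.GrothendieckGroup.of = Algebra.GrothendieckGroup.of.comp φ :=
  Algebra.GrothendieckGroup.lift.symm_apply_apply _

lemma gp_hom_ext {M G : Type*} [CommMonoid M] [CommGroup G]
    {φ ψ : Algebra.GrothendieckGroup M →* G}
    (h : φ.comp Algebra.GrothendieckGroup.of = ψ.comp Algebra.GrothendieckGroup.of) : φ = ψ :=
  Algebra.GrothendieckGroup.lift.symm.injective h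

lemma gpMap_comp {M N P : Type*} [CommMonoid M] [CommMonoid N] [CommMonoid P]
    (φ : M →* N) (ψ : N →* P) : gpMap (ψ.comp φ) = (gpMap ψ).comp (gpMap φ) :=
  gp_hom_ext (by
    rw [gpMap_comp_of, MonoidHom.comp_assoc, gpMap_comp_of, ← MonoidHom.comp_assoc,
      ← MonoidHom.comp_assoc, gpMap_comp_of])

/-- Group completion `M ↦ M^gp`. -/
def groupCompletion : CommMonCat.{u} ⥤ CommGrpCat.{u} where
  obj M := CommGrpCat.of (Algebra.GrothendieckGroup M)
  map φ := CommGrpCat.ofHom (gpMap φ.hom)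
  map_id _ := CommGrpCat.hom_ext (gp_hom_ext (gpMap_comp_of _))
  map_comp φ ψ := CommGrpCat.hom_ext (gpMap_comp φ.hom ψ.hom)

/-- Sheaves of abelian groups on the small étale site, associated with presheaves. -/
abbrev etaleSheafify (Y : Scheme.{u}) :
    (Y.Etaleᵒᵖ ⥤ AddCommGrpCat.{u}) ⥤ Sheaf Y.smallEtaleTopology AddCommGrpCat.{u} :=
  presheafToSheaf _ _

/-- The morphism of sheaves `P^# ⟶ f_* Q^#` induced by a morphism of presheaves `P ⟶ f_* Q`. -/
def sheafifyToPushforward {Z Y : Scheme.{u}} (f : Z ⟶ Y) {P : Y.Etaleᵒᵖ ⥤ AddCommGrpCat.{u}}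
    {Q : Z.Etaleᵒᵖ ⥤ AddCommGrpCat.{u}} (φ : P ⟶ (etalePullback f).op ⋙ Q) :
    (etaleSheafify Y).obj P ⟶ (pushforward f).obj ((etaleSheafify Z).obj Q) :=
  ((sheafificationAdjunction _ _).homEquiv P ((pushforward f).obj ((etaleSheafify Z).obj Q))).symm
    (φ ≫ Functor.whiskerLeft (etalePullback f).op (toSheafify Z.smallEtaleTopology Q))

/-- The presheaf `U ↦ 𝒪(U)ˣ` (written additively). -/
abbrev unitsPresheaf (Y : Scheme.{u}) : Y.Etaleᵒᵖ ⥤ AddCommGrpCat.{u} :=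
  structMonoid Y ⋙ CommMonCat.units ⋙ CommGrpCat.toAddCommGrp

/-- The étale sheaf of abelian groups `𝒪_Y^×` (associated with `U ↦ 𝒪(U)ˣ`). -/
def unitsSheaf (Y : Scheme.{u}) : Sheaf Y.smallEtaleTopology AddCommGrpCat.{u} :=
  (etaleSheafify Y).obj (unitsPresheaf Y)

/-- The map `𝒪_Y^× ⟶ f_* 𝒪_Z^×`. -/
def unitsSheafMap {Z Y : Scheme.{u}} (f : Z ⟶ Y) :
    unitsSheaf Y ⟶ (pushforward f).obj (unitsSheaf Z) :=
  sheafifyToPushforward f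
    (Functor.whiskerRight (structMap f) (CommMonCat.units ⋙ CommGrpCat.toAddCommGrp))

/-! ### Log structures and log schemes -/

/-- A log structure on `Y`: a sheaf of commutative monoids `ℳ` on the small étale site with a
homomorphism `α : ℳ ⟶ (𝒪_Y, ·)` such that `α⁻¹(𝒪_Y^×) ⟶ 𝒪_Y^×` is an isomorphism. -/
structure LogStructure (Y : Scheme.{u}) where
  /-- the sheaf of monoids `ℳ` -/
  sheaf : Sheaf Y.smallEtaleTopology CommMonCat.{u}
  /-- the structure map `α` -/
  α : sheaf.obj ⟶ structMonoid Y
  existsUnique_unit : ∀ (U : Y.Etale) (v : ((structMonoid Y).obj (op U))ˣ),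
    ∃! m : sheaf.obj.obj (op U), α.app (op U) m = v

namespace LogStructure

variable {Y : Scheme.{u}} (L : LogStructure Y)

/-- The inclusion `𝒪(U)ˣ → ℳ(U)`, inverse to `α` over the units. -/
def unit (U : Y.Etaleᵒᵖ) : ((structMonoid Y).obj U)ˣ →* L.sheaf.obj.obj U where
  toFun v := (L.existsUnique_unit U.unop v).choose
  map_one' := ((L.existsUnique_unit U.unop 1).choose_spec.2 _ (by simp)).symm
  map_mul' v w := ((L.existsUnique_unit U.unop (v * w)).choose_spec.2 _ (by
    have h₁ := (L.existsUnique_unit U.unop v).choose_spec.1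
    have h₂ := (L.existsUnique_unit U.unop w).choose_spec.1
    dsimp at h₁ h₂ ⊢
    rw [map_mul, h₁, h₂])).symm

lemma α_unit (U : Y.Etaleᵒᵖ) (v : ((structMonoid Y).obj U)ˣ) : L.α.app U (L.unit U v) = v :=
  (L.existsUnique_unit U.unop v).choose_spec.1

lemma eq_unit {U : Y.Etaleᵒᵖ} {v : ((structMonoid Y).obj U)ˣ} {m : L.sheaf.obj.obj U}
    (h : L.α.app U m = v) : m = L.unit U v :=
  (L.existsUnique_unit U.unop v).choose_spec.2 m h

lemma map_unit {U V : Y.Etaleᵒᵖ} (g : U ⟶ V) (v : ((structMonoid Y).obj U)ˣ) :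
    L.sheaf.obj.map g (L.unit U v) =
      L.unit V (Units.map ((structMonoid Y).map g).hom v) := by
  apply L.eq_unit
  change (L.sheaf.obj.map g ≫ L.α.app V).hom _ = _
  rw [L.α.naturality g]
  change ((structMonoid Y).map g).hom (L.α.app U (L.unit U v)) = _
  rw [α_unit]
  rfl

/-- The presheaf `U ↦ ℳ(U)^gp` (written additively). -/
abbrev gpPresheaf : Y.Etaleᵒᵖ ⥤ AddCommGrpCat.{u} :=
  L.sheaf.obj ⋙ groupCompletion ⋙ CommGrpCat.toAddCommGrp

/-- The étale sheaf of abelian groups `ℳ^gp`, associated with `U ↦ ℳ(U)^gp`. -/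
def gpSheaf : Sheaf Y.smallEtaleTopology AddCommGrpCat.{u} :=
  (etaleSheafify Y).obj L.gpPresheaf

/-- The map of presheaves `𝒪(U)ˣ → ℳ(U) → ℳ(U)^gp`. -/
def unitsToGpPresheaf :
    structMonoid Y ⋙ CommMonCat.units ⟶ L.sheaf.obj ⋙ groupCompletion where
  app U := CommGrpCat.ofHom (Algebra.GrothendieckGroup.of.comp (L.unit U))
  naturality U V g := CommGrpCat.hom_ext (by
    ext v
    change Algebra.GrothendieckGroup.of (L.unit V (Units.map ((structMonoid Y).map g).hom v)) =
      ((gpMap (L.sheaf.obj.map g).hom).comp Algebra.GrothendieckGroup.of) (L.unit U v)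
    rw [gpMap_comp_of]
    exact congrArg _ (L.map_unit g v).symm)

/-- The canonical map `𝒪_Y^× ⟶ ℳ^gp`. -/
def unitsToGp : unitsSheaf Y ⟶ L.gpSheaf :=
  (etaleSheafify Y).map (Functor.whiskerRight L.unitsToGpPresheaf CommGrpCat.toAddCommGrp)

/-- `L` restricts to the trivial log structure `𝒪^×` over the open subset `W` of `Y`: over every
étale `U ⟶ Y` with image in `W`, all sections of `ℳ` are units, i.e. `𝒪(U)ˣ = ℳ(U)`. -/
def IsTrivialOn (W : Set Y) : Prop :=
  ∀ U : Y.Etale, Set.range (estr U) ⊆ W → ∀ m : L.sheaf.obj.obj (op U), IsUnit (L.α.app (op U) m)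

end LogStructure

/-- Given a homomorphism `γ : Q → R` of commutative monoids, the congruence on `Q × Rˣ` whose
quotient is the pushout `Q ⊕_{γ⁻¹(Rˣ)} Rˣ` of commutative monoids: `(q, v) ~ (q₂, v₂)` if and only
if `q h = q₂ h₂` and `v γ(h₂) = v₂ γ(h)` for some `h, h₂ ∈ γ⁻¹(Rˣ)`. -/
def logCon {Q R : Type*} [CommMonoid Q] [CommMonoid R] (γ : Q →* R) : Con (Q × Rˣ) where
  r x y := ∃ (h h₂ : Q) (w w₂ : Rˣ), γ h = w ∧ γ h₂ = w₂ ∧ x.1 * h = y.1 * h₂ ∧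
    x.2 * w₂ = y.2 * w
  iseqv := by
    refine ⟨fun x => ⟨1, 1, 1, 1, by simp, by simp, rfl, rfl⟩, ?_, ?_⟩
    · rintro x y ⟨h, h₂, w, w₂, e, e₂, k, k₂⟩
      exact ⟨h₂, h, w₂, w, e₂, e, k.symm, k₂.symm⟩
    · rintro x y z ⟨h, h₂, w, w₂, e, e₂, k, k₂⟩ ⟨g, g₂, u, u₂, d, d₂, l, l₂⟩
      refine ⟨h * g, g₂ * h₂, w * u, u₂ * w₂, by simp [e, d], by simp [e₂, d₂], ?_, ?_⟩
      · rw [← mul_assoc, k, mul_right_comm, l, mul_assoc]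
      · calc x.2 * (u₂ * w₂) = (x.2 * w₂) * u₂ := by rw [mul_comm u₂, mul_assoc]
          _ = (y.2 * u₂) * w := by rw [k₂, mul_right_comm]
          _ = z.2 * (w * u) := by rw [l₂, mul_assoc, mul_comm u]
  mul' := by
    rintro a b c d ⟨h, h₂, w, w₂, e, e₂, k, k₂⟩ ⟨g, g₂, u, u₂, f, f₂, l, l₂⟩
    refine ⟨h * g, h₂ * g₂, w * u, w₂ * u₂, by simp [e, f], by simp [e₂, f₂], ?_, ?_⟩
    · simp only [Prod.fst_mul]
      rw [mul_mul_mul_comm, k, l, mul_mul_mul_comm]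
    · simp only [Prod.snd_mul]
      rw [mul_mul_mul_comm, k₂, l₂, mul_mul_mul_comm]

/-! ### Fine and saturated log structures -/

/-- A fine and saturated (fs) monoid: finitely generated, integral (that is, cancellative) and
saturated, i.e. any `x ∈ P^gp` with `x ^ n ∈ P` for some `n ≥ 1` lies in `P`. -/
structure IsFSMonoid (P : Type*) [CommMonoid P] : Prop where
  fg : Monoid.FG P
  integral : ∀ a b c : P, a * b = a * c → b = c
  saturated : ∀ (x : Algebra.GrothendieckGroup P) (n : ℕ), 0 < n →
    (∃ p : P, Algebra.GrothendieckGroup.of p = x ^ n) → ∃ p : P, Algebra.GrothendieckGroup.of p = x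

namespace LogStructure

variable {Y : Scheme.{u}} (L : LogStructure Y)

/-- The composite `P → ℳ(U) → ℳ(V) → 𝒪(V)` for a homomorphism `β : P → ℳ(U)` and `V ⟶ U`. -/
def chartMap {U V : Y.Etale} {P : Type*} [CommMonoid P] (β : P →* L.sheaf.obj.obj (op U))
    (k : V ⟶ U) : P →* (structMonoid Y).obj (op V) :=
  ((L.α.app (op V)).hom.comp (L.sheaf.obj.map k.op).hom).comp β

/-- `β : P → ℳ(U)` is a chart of `ℳ` over `U`: the log structure on `U` associated with
`P → 𝒪_U` maps isomorphically to `ℳ|_U`. The associated log structure is the sheafification of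
the presheaf pushout `V ↦ P ⊕_{γ⁻¹(𝒪(V)ˣ)} 𝒪(V)ˣ`, so the condition says that the map
`(p, v) ↦ v · β(p)` from this presheaf to `ℳ|_U` is locally surjective and locally injective. -/
structure IsChart {U : Y.Etale} {P : Type*} [CommMonoid P] (β : P →* L.sheaf.obj.obj (op U)) :
    Prop where
  locally_surjective : ∀ (V : Y.Etale) (k : V ⟶ U) (m : L.sheaf.obj.obj (op V)),
    ∃ S ∈ Y.smallEtaleTopology V, ∀ (W : Y.Etale) (j : W ⟶ V), S j →
      ∃ (p : P) (v : ((structMonoid Y).obj (op W))ˣ),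
        L.sheaf.obj.map j.op m = L.unit (op W) v * L.sheaf.obj.map (j ≫ k).op (β p)
  locally_injective : ∀ (V : Y.Etale) (k : V ⟶ U) (p q : P)
    (v w : ((structMonoid Y).obj (op V))ˣ),
    L.unit (op V) v * L.sheaf.obj.map k.op (β p) = L.unit (op V) w * L.sheaf.obj.map k.op (β q) →
    ∃ S ∈ Y.smallEtaleTopology V, ∀ (W : Y.Etale) (j : W ⟶ V), S j →
      logCon (L.chartMap β (j ≫ k))
        (p, Units.map ((structMonoid Y).map j.op).hom v)
        (q, Units.map ((structMonoid Y).map j.op).hom w)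

/-- A fine and saturated log structure: étale locally on `Y`, it has a chart by an fs monoid. -/
def IsFS : Prop :=
  ∃ S ∈ Y.smallEtaleTopology (etaleTop Y), ∀ (U : Y.Etale) (k : U ⟶ etaleTop Y), S k →
    ∃ (P : Type u) (_ : CommMonoid P) (β : P →* L.sheaf.obj.obj (op U)),
      IsFSMonoid P ∧ L.IsChart β

end LogStructure

/-! ### Log schemes and strict morphisms -/

/-- A log scheme. -/
structure LogScheme where
  /-- the underlying scheme -/
  scheme : Scheme.{u}
  /-- the log structure -/
  log : LogStructure scheme

/-- A morphism of log schemes `Z ⟶ Y`: a morphism `f` of the underlying schemes together with a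
homomorphism `f♭ : ℳ_Y ⟶ f_* ℳ_Z` compatible with `𝒪_Y ⟶ f_* 𝒪_Z`. -/
structure LogScheme.Hom (Z Y : LogScheme.{u}) where
  /-- the morphism of underlying schemes -/
  base : Z.scheme ⟶ Y.scheme
  /-- the homomorphism of sheaves of monoids -/
  flat : Y.log.sheaf.obj ⟶ (etalePullback base).op ⋙ Z.log.sheaf.obj
  comm : flat ≫ Functor.whiskerLeft (etalePullback base).op Z.log.α = Y.log.α ≫ structMap base

namespace LogScheme.Hom

variable {Z Y : LogScheme.{u}} (f : Hom Z Y)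

/-- The map `ℳ_Y(U) → ℳ_Z(U ×_Y Z) → ℳ_Z(W)` for `U` étale over `Y`, `W` étale over `Z`,
and a morphism `g : W ⟶ U ×_Y Z` over `Z` (that is, a morphism `W ⟶ U` over `Z ⟶ Y`). -/
def pullSection {U : Y.scheme.Etale} {W : Z.scheme.Etale} (g : W ⟶ (etalePullback f.base).obj U) :
    Y.log.sheaf.obj.obj (op U) →* Z.log.sheaf.obj.obj (op W) :=
  (Z.log.sheaf.obj.map g.op).hom.comp (f.flat.app (op U)).hom

/-- The composite `ℳ_Y(U) → ℳ_Z(W) → 𝒪_Z(W)`. -/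
def pullSectionα {U : Y.scheme.Etale} {W : Z.scheme.Etale} (g : W ⟶ (etalePullback f.base).obj U) :
    Y.log.sheaf.obj.obj (op U) →* (structMonoid Z.scheme).obj (op W) :=
  (Z.log.α.app (op W)).hom.comp (f.pullSection g)

/-- `f` is strict: the pullback log structure `f^* ℳ_Y`, i.e. the log structure associated with
`f⁻¹ ℳ_Y ⟶ 𝒪_Z`, maps isomorphically to `ℳ_Z`. Here `f⁻¹ ℳ_Y` is the sheafification of
`W ↦ colim ℳ_Y(U)`, the (filtered) colimit over all morphisms `W ⟶ U` over `f` with `U` étale over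
`Y`. Hence `f^* ℳ_Y` is the sheafification of
`W ↦ colim (ℳ_Y(U) ⊕_{γ⁻¹(𝒪_Z(W)ˣ)} 𝒪_Z(W)ˣ)` and the condition says that the map
`(n, v) ↦ v · f♭(n)` from this presheaf to `ℳ_Z` is locally surjective and locally injective. -/
structure IsStrict : Prop where
  locally_surjective : ∀ (W : Z.scheme.Etale) (m : Z.log.sheaf.obj.obj (op W)),
    ∃ S ∈ Z.scheme.smallEtaleTopology W, ∀ (W₁ : Z.scheme.Etale) (j : W₁ ⟶ W), S j →
      ∃ (U : Y.scheme.Etale) (g : W₁ ⟶ (etalePullback f.base).obj U)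
        (n : Y.log.sheaf.obj.obj (op U)) (v : ((structMonoid Z.scheme).obj (op W₁))ˣ),
        Z.log.sheaf.obj.map j.op m = Z.log.unit (op W₁) v * f.pullSection g n
  locally_injective : ∀ (U : Y.scheme.Etale) (W : Z.scheme.Etale)
    (g : W ⟶ (etalePullback f.base).obj U) (n n₂ : Y.log.sheaf.obj.obj (op U))
    (v v₂ : ((structMonoid Z.scheme).obj (op W))ˣ),
    Z.log.unit (op W) v * f.pullSection g n = Z.log.unit (op W) v₂ * f.pullSection g n₂ →
    ∃ S ∈ Z.scheme.smallEtaleTopology W, ∀ (W₁ : Z.scheme.Etale) (j : W₁ ⟶ W), S j →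
      ∃ (U₁ : Y.scheme.Etale) (r : U₁ ⟶ U) (g₁ : W₁ ⟶ (etalePullback f.base).obj U₁),
        g₁ ≫ (etalePullback f.base).map r = j ≫ g ∧
        logCon (f.pullSectionα g₁)
          (Y.log.sheaf.obj.map r.op n, Units.map ((structMonoid Z.scheme).map j.op).hom v)
          (Y.log.sheaf.obj.map r.op n₂, Units.map ((structMonoid Z.scheme).map j.op).hom v₂)

/-- A strict closed immersion of log schemes. -/
structure IsStrictClosedImmersion : Prop where
  isClosedImmersion : IsClosedImmersion f.base
  isStrict : f.IsStrict

/-- The map `ℳ_Y^gp ⟶ f_* ℳ_Z^gp`. -/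
def gpSheafMap : Y.log.gpSheaf ⟶ (pushforward f.base).obj Z.log.gpSheaf :=
  sheafifyToPushforward f.base
    (Functor.whiskerRight f.flat (groupCompletion ⋙ CommGrpCat.toAddCommGrp))

end LogScheme.Hom

/-! ### Derived global sections and homotopy cartesian squares -/

/-- The augmentation `F ⟶ I⁰` of an injective resolution `F ⟶ I^•`. -/
def augmentation {C : Type*} [Category* C] [Abelian C] {F : C} (I : InjectiveResolution F) :
    F ⟶ I.cochainComplex.X 0 :=
  (HomologicalComplex.singleObjXSelf (.up ℤ) 0 F).inv ≫ I.ι'.f 0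

/-- The derived global sections `RΓ_ét(Y, F)`, computed by an injective resolution `I` of `F`. -/
def RGamma {Y : Scheme.{u}} {F : Sheaf Y.smallEtaleTopology AddCommGrpCat.{u}}
    (I : InjectiveResolution F) : CochainComplex AddCommGrpCat.{u} ℤ :=
  ((globalSections Y).mapHomologicalComplex _).obj I.cochainComplex

section Square

variable {Z Y : Scheme.{u}} (f : Z ⟶ Y)
  {F G : Sheaf Y.smallEtaleTopology AddCommGrpCat.{u}}
  {E H : Sheaf Z.smallEtaleTopology AddCommGrpCat.{u}}

/-- The push-forward `f_* I` of the injective resolution `I`, which computes `Rf_*`. -/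
abbrev pushforwardComplex (I : InjectiveResolution E) :
    CochainComplex (Sheaf Y.smallEtaleTopology AddCommGrpCat.{u}) ℤ :=
  ((pushforward f).mapHomologicalComplex _).obj I.cochainComplex

/-- The identification `Γ(Y, f_* I) ⟶ Γ(Z, I)`. -/
def RGammaPushforward (I : InjectiveResolution E) :
    ((globalSections Y).mapHomologicalComplex _).obj (pushforwardComplex f I) ⟶ RGamma I :=
  (NatTrans.mapHomologicalComplex (globalSectionsPushforward f) _).app I.cochainComplex

/-- Let `φ : F ⟶ f_* E`, `ψ : G ⟶ f_* H`, `a : F ⟶ G` and `b : E ⟶ H` form a commutative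
square, i.e. `a ≫ ψ = φ ≫ f_* b`. This is the data needed to represent the induced square
```
  RΓ(Y, F) ----> RΓ(Z, E)
     |              |
  RΓ(Y, G) ----> RΓ(Z, H)
```
by a homotopy commutative square of cochain complexes: injective resolutions of the four sheaves,
lifts of the four maps to these resolutions (with `F ⟶ f_* E` lifted to a map into `f_* J`,
where `J` is the resolution of `E`), and a homotopy which makes the square of sheaves of complexes
on `Y` commute. Each of these choices is unique up to homotopy (and the homotopies up to higher
homotopies), so that all such models represent the same square in the derived `∞`-category. -/
structure RGammaSquare (φ : F ⟶ (pushforward f).obj E) (ψ : G ⟶ (pushforward f).obj H)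
    (a : F ⟶ G) (b : E ⟶ H) where
  /-- the resolution of `F` -/
  resF : InjectiveResolution F
  /-- the resolution of `G` -/
  resG : InjectiveResolution G
  /-- the resolution of `E` -/
  resE : InjectiveResolution E
  /-- the resolution of `H` -/
  resH : InjectiveResolution H
  /-- the lift of `φ` -/
  top : resF.cochainComplex ⟶ pushforwardComplex f resE
  top_comm : augmentation resF ≫ top.f 0 = φ ≫ (pushforward f).map (augmentation resE)
  /-- the lift of `ψ` -/
  bottom : resG.cochainComplex ⟶ pushforwardComplex f resH
  bottom_comm : augmentation resG ≫ bottom.f 0 = ψ ≫ (pushforward f).map (augmentation resH)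
  /-- the lift of `a` -/
  left : resF.cochainComplex ⟶ resG.cochainComplex
  left_comm : augmentation resF ≫ left.f 0 = a ≫ augmentation resG
  /-- the lift of `b` -/
  right : resE.cochainComplex ⟶ resH.cochainComplex
  right_comm : augmentation resE ≫ right.f 0 = b ≫ augmentation resH
  /-- the homotopy -/
  homotopy : Homotopy (top ≫ ((pushforward f).mapHomologicalComplex _).map right) (left ≫ bottom)

namespace RGammaSquare

variable {f} {φ : F ⟶ (pushforward f).obj E} {ψ : G ⟶ (pushforward f).obj H}
  {a : F ⟶ G} {b : E ⟶ H} (S : RGammaSquare f φ ψ a b)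

/-- The map `RΓ(Y, F) ⟶ RΓ(Z, E)`. -/
def topMap : RGamma S.resF ⟶ RGamma S.resE :=
  ((globalSections Y).mapHomologicalComplex _).map S.top ≫ RGammaPushforward f S.resE

/-- The map `RΓ(Y, G) ⟶ RΓ(Z, H)`. -/
def bottomMap : RGamma S.resG ⟶ RGamma S.resH :=
  ((globalSections Y).mapHomologicalComplex _).map S.bottom ≫ RGammaPushforward f S.resH

/-- The map `RΓ(Y, F) ⟶ RΓ(Y, G)`. -/
def leftMap : RGamma S.resF ⟶ RGamma S.resG :=
  ((globalSections Y).mapHomologicalComplex _).map S.left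

/-- The map `RΓ(Z, E) ⟶ RΓ(Z, H)`. -/
def rightMap : RGamma S.resE ⟶ RGamma S.resH :=
  ((globalSections Z).mapHomologicalComplex _).map S.right

lemma topMap_rightMap : S.topMap ≫ S.rightMap =
    ((globalSections Y).mapHomologicalComplex _).map
      (S.top ≫ ((pushforward f).mapHomologicalComplex _).map S.right) ≫
        RGammaPushforward f S.resH := by
  have h := (NatTrans.mapHomologicalComplex (globalSectionsPushforward f) (.up ℤ)).naturality S.right
  rw [Functor.map_comp, Category.assoc]
  refine (Category.assoc _ _ _).trans ?_
  exact congrArg (((globalSections Y).mapHomologicalComplex _).map S.top ≫ ·) h.symm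

lemma leftMap_bottomMap : S.leftMap ≫ S.bottomMap =
    ((globalSections Y).mapHomologicalComplex _).map (S.left ≫ S.bottom) ≫
      RGammaPushforward f S.resH := by
  rw [Functor.map_comp, Category.assoc]
  rfl

/-- The homotopy which makes the square of complexes of derived global sections commute. -/
def homotopyMap : Homotopy (S.topMap ≫ S.rightMap) (S.leftMap ≫ S.bottomMap) :=
  (Homotopy.ofEq S.topMap_rightMap).trans
    ((((globalSections Y).mapHomotopy S.homotopy).compRight (RGammaPushforward f S.resH)).trans
      (Homotopy.ofEq S.leftMap_bottomMap.symm))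

/-- The square is (homotopy) cartesian: the induced map from the cone of
`RΓ(Y, F) ⟶ RΓ(Z, E)` to the cone of `RΓ(Y, G) ⟶ RΓ(Z, H)` (equivalently, up to a shift, the
induced map on the homotopy fibres) is a quasi-isomorphism. -/
def IsCartesian : Prop :=
  QuasiIso (CochainComplex.mappingCone.mapOfHomotopy S.homotopyMap)

end RGammaSquare

end Square

/-- The data representing the square with top row `RΓ_ét(Y, 𝒪_Y^×) ⟶ RΓ_ét(Z, 𝒪_Z^×)` and bottom row
`RΓ_ét(Y, ℳ_Y^gp) ⟶ RΓ_ét(Z, ℳ_Z^gp)` attached to a morphism `i : Z ⟶ Y` of log schemes. -/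
abbrev LogScheme.Hom.PicardSquare {Z Y : LogScheme.{u}} (i : LogScheme.Hom Z Y) :=
  RGammaSquare i.base (unitsSheafMap i.base) i.gpSheafMap Y.log.unitsToGp Z.log.unitsToGp

end LogGeometry

/-! The statement reduces to one about étale sheaves on `Y`. Push-forward along the closed immersion
`i` is exact and preserves injectives, so `i_*` of an injective resolution on `Z` is an injective
resolution on `Y`, and `RΓ(Z, E)` is `RΓ(Y, i_* E)`. It therefore suffices that in the square of
sheaves formed by `𝒪_Y^× ⟶ i_* 𝒪_Z^×` and `ℳ_Y^gp ⟶ i_* ℳ_Z^gp` both horizontal maps are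
epimorphisms and the induced map on their kernels is an isomorphism. The passage from this to
complexes is `RGammaSquare.isCartesian_of_isIso_kernel`.

Surjectivity: units on a closed subscheme lift locally (`exists_lift_unit`), and by strictness a
section of `ℳ_Z` is locally a unit times the image of a section of `ℳ_Y`
(`IsStrict.exists_onSections_eq`).

Kernels: let `m/n` be a local section of `ℳ_Y^gp` that dies on `Z`. Since `ℳ_Z` is integral, `m` and
`n` agree in `ℳ_Z`. By strictness `m h = n h'` locally, with `h` and `h'` invertible on `Z`, hence
invertible near `Z`, so `m/n` is a unit near `Z`. Away from `Z` the log structure is trivial and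
every section is a unit (`IsStrict.exists_unit_mul_eq`). Integrality also makes `𝒪^× ⟶ ℳ^gp` a
monomorphism on `Y` and on `Z`, so that this unit is unique and restricts to `1` on `Z`.

The geometric input, used for exactness of `i_*` and for both lifting statements, is that étale
morphisms to `Z` extend locally to étale morphisms to `Y` (`exists_isPullback_of_etale`). -/

namespace LogGeometry

/-! ### Mapping cones of short exact sequences -/

section HomologicalAlgebra

open CochainComplex CochainComplex.mappingCone HomComplex

variable {C : Type*} [Category* C] [Abelian C]

-- In the derived category the cones complete distinguished triangles, and a morphism of triangles
-- with two invertible components has its third invertible.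
attribute [local instance] HasDerivedCategory.standard in
lemma quasiIso_mappingCone_map {K₁ L₁ K₂ L₂ : CochainComplex C ℤ} (φ₁ : K₁ ⟶ L₁) (φ₂ : K₂ ⟶ L₂)
    (a : K₁ ⟶ K₂) (b : L₁ ⟶ L₂) (comm : φ₁ ≫ b = a ≫ φ₂) [QuasiIso a] [QuasiIso b] :
    QuasiIso (mappingCone.map φ₁ φ₂ a b comm) := by
  rw [← DerivedCategory.isIso_Q_map_iff_quasiIso]
  have := Pretriangulated.isIso₃_of_isIso₁₂
    (DerivedCategory.Q.mapTriangle.map (triangleMap φ₁ φ₂ a b comm))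
    (DerivedCategory.mappingCone_triangle_distinguished φ₁)
    (DerivedCategory.mappingCone_triangle_distinguished φ₂)
    (inferInstanceAs (IsIso (DerivedCategory.Q.map a)))
    (inferInstanceAs (IsIso (DerivedCategory.Q.map b)))
  exact this

/-- The equivalence from the cone of `inr φ` to `K⟦1⟧` is strictly natural in this direction: it is
zero on the `inl` component and the connecting map of the triangle on the `inr` component. -/
lemma map_inr_inr_rotate {K₁ L₁ K₂ L₂ : CochainComplex C ℤ} (φ₁ : K₁ ⟶ L₁) (φ₂ : K₂ ⟶ L₂)
    (a : K₁ ⟶ K₂) (b : L₁ ⟶ L₂) (comm : φ₁ ≫ b = a ≫ φ₂)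
    (comm' : inr φ₁ ≫ mappingCone.map φ₁ φ₂ a b comm = b ≫ inr φ₂) :
    mappingCone.map (inr φ₁) (inr φ₂) b (mappingCone.map φ₁ φ₂ a b comm) comm' ≫
      (rotateHomotopyEquiv φ₂).inv =
        (rotateHomotopyEquiv φ₁).inv ≫ (CategoryTheory.shiftFunctor (CochainComplex C ℤ) (1 : ℤ)).map a := by
  have t₁ : δ (-1) 0 (0 : Cochain L₁ (K₁⟦(1 : ℤ)⟧) (-1)) =
      Cochain.ofHom (inr φ₁ ≫ (triangle φ₁).mor₃) :=
    (δ_zero _ _).trans ((congrArg Cochain.ofHom (inr_triangleδ φ₁)).trans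
      (Cochain.ofHom_zero _ _)).symm
  have t₂ : δ (-1) 0 (0 : Cochain L₂ (K₂⟦(1 : ℤ)⟧) (-1)) =
      Cochain.ofHom (inr φ₂ ≫ (triangle φ₂).mor₃) :=
    (δ_zero _ _).trans ((congrArg Cochain.ofHom (inr_triangleδ φ₂)).trans
      (Cochain.ofHom_zero _ _)).symm
  have h₂ : inr (inr φ₁) ≫ (rotateHomotopyEquiv φ₁).inv = (triangle φ₁).mor₃ :=
    inr_desc _ _ _ t₁
  have h₂' : inr (inr φ₂) ≫ (rotateHomotopyEquiv φ₂).inv = (triangle φ₂).mor₃ :=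
    inr_desc _ _ _ t₂
  have h₃ : inr (inr φ₁) ≫ mappingCone.map (inr φ₁) (inr φ₂) b (mappingCone.map φ₁ φ₂ a b comm)
      comm' = mappingCone.map φ₁ φ₂ a b comm ≫ inr (inr φ₂) := inr_desc _ _ _ _
  ext n
  apply ext_from _ (n + 1) n rfl
  · have e₁ : (inl (inr φ₁)).v (n + 1) n (by lia) ≫ (rotateHomotopyEquiv φ₁).inv.f n = 0 :=
      (inl_v_desc_f (inr φ₁) _ _ t₁ _ _ _).trans (Cochain.zero_v _ _ _)
    have e₂ : (inl (inr φ₂)).v (n + 1) n (by lia) ≫ (rotateHomotopyEquiv φ₂).inv.f n = 0 :=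
      (inl_v_desc_f (inr φ₂) _ _ t₂ _ _ _).trans (Cochain.zero_v _ _ _)
    have e₃ : (inl (inr φ₁)).v (n + 1) n (by lia) ≫ (mappingCone.map (inr φ₁) (inr φ₂) b
        (mappingCone.map φ₁ φ₂ a b comm) comm').f n =
        b.f (n + 1) ≫ (inl (inr φ₂)).v (n + 1) n (by lia) :=
      (inl_v_desc_f (inr φ₁) _ _ _ _ _ _).trans (by simp)
    rw [HomologicalComplex.comp_f, HomologicalComplex.comp_f, reassoc_of% e₃, e₂, reassoc_of% e₁]
    exact comp_zero.trans zero_comp.symm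
  · rw [← HomologicalComplex.comp_f, ← HomologicalComplex.comp_f, reassoc_of% h₃, h₂',
      reassoc_of% h₂]
    exact congr_arg (fun f => f.f n) (triangleMap φ₁ φ₂ a b comm).comm₃.symm

/-- For a short exact sequence the quotient is quasi-isomorphic to the cone of `S.f`, so the cone of
`S.g` is quasi-isomorphic to the cone of `inr S.f`, that is, to the shift of the subobject. These
comparisons are natural, which reduces the claim to `f.τ₁`. -/
lemma quasiIso_map_of_shortExact {S₁ S₂ : ShortComplex (CochainComplex C ℤ)} (f : S₁ ⟶ S₂)
    (h₁ : S₁.ShortExact) (h₂ : S₂.ShortExact) [QuasiIso f.τ₁] :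
    QuasiIso (mappingCone.map S₁.g S₂.g f.τ₂ f.τ₃ f.comm₂₃.symm) := by
  have := mappingCone.quasiIso_descShortComplex h₁
  have := mappingCone.quasiIso_descShortComplex h₂
  let m := mappingCone.map S₁.f S₂.f f.τ₁ f.τ₂ f.comm₁₂.symm
  have hm : inr S₁.f ≫ m = f.τ₂ ≫ inr S₂.f := by simp [m, mappingCone.map]
  have e₁ : inr S₁.f ≫ descShortComplex S₁ = 𝟙 _ ≫ S₁.g := by simp
  have e₂ : inr S₂.f ≫ descShortComplex S₂ = 𝟙 _ ≫ S₂.g := by simp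
  have q₁ := quasiIso_mappingCone_map _ _ _ _ e₁
  have q₂ := quasiIso_mappingCone_map _ _ _ _ e₂
  have q₃ : QuasiIso (mappingCone.map (inr S₁.f) (inr S₂.f) f.τ₂ m hm) := by
    have h := map_inr_inr_rotate S₁.f S₂.f f.τ₁ f.τ₂ f.comm₁₂.symm hm
    have : QuasiIso (f.τ₁⟦(1 : ℤ)⟧') := inferInstance
    have r₁ : QuasiIso (rotateHomotopyEquiv S₁.f).inv :=
      inferInstanceAs (QuasiIso (rotateHomotopyEquiv S₁.f).symm.hom)
    have r₂ : QuasiIso (rotateHomotopyEquiv S₂.f).inv :=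
      inferInstanceAs (QuasiIso (rotateHomotopyEquiv S₂.f).symm.hom)
    have : QuasiIso (mappingCone.map (inr S₁.f) (inr S₂.f) f.τ₂ m hm ≫
      (rotateHomotopyEquiv S₂.f).inv) := by rw [h]; infer_instance
    exact quasiIso_of_comp_right _ (rotateHomotopyEquiv S₂.f).inv
  have h : mappingCone.map _ _ _ _ e₁ ≫ mappingCone.map S₁.g S₂.g f.τ₂ f.τ₃ f.comm₂₃.symm =
      mappingCone.map (inr S₁.f) (inr S₂.f) f.τ₂ m hm ≫ mappingCone.map _ _ _ _ e₂ := by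
    rw [← mappingCone.map_comp, ← mappingCone.map_comp]
    congr 1
    · simp
    · exact (mappingCone.descShortComplex_naturality f).symm
  have : QuasiIso (mappingCone.map _ _ _ _ e₁ ≫
      mappingCone.map S₁.g S₂.g f.τ₂ f.τ₃ f.comm₂₃.symm) := by rw [h]; infer_instance
  exact quasiIso_of_comp_left (mappingCone.map _ _ _ _ e₁) _

/-- In a commutative square with epimorphic horizontal maps, if the induced map on the kernels is
an isomorphism, then the induced map on mapping cones is a quasi-isomorphism. -/
lemma quasiIso_map_single_of_isIso_kernel {F E G H : C} (φ : F ⟶ E) (ψ : G ⟶ H) (a : F ⟶ G)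
    (b : E ⟶ H) (comm : φ ≫ b = a ≫ ψ) [Epi φ] [Epi ψ] [IsIso (kernel.map φ ψ a b comm)] :
    QuasiIso (mappingCone.map ((singleFunctor C 0).map φ) ((singleFunctor C 0).map ψ)
      ((singleFunctor C 0).map a) ((singleFunctor C 0).map b)
      (by rw [← Functor.map_comp, ← Functor.map_comp, comm])) := by
  let T₁ := ShortComplex.mk (kernel.ι φ) φ (by simp)
  let T₂ := ShortComplex.mk (kernel.ι ψ) ψ (by simp)
  have t₁ : T₁.ShortExact := { exact := ShortComplex.exact_kernel φ }
  have t₂ : T₂.ShortExact := { exact := ShortComplex.exact_kernel ψ }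
  let g : T₁ ⟶ T₂ :=
    { τ₁ := kernel.map φ ψ a b comm, τ₂ := a, τ₃ := b
      comm₁₂ := by simp [T₁, T₂], comm₂₃ := comm.symm }
  have e : IsIso g.τ₁ := by dsimp [g]; infer_instance
  let g' := (singleFunctor C 0).mapShortComplex.map g
  have : QuasiIso g'.τ₁ := by
    change QuasiIso ((singleFunctor C 0).map g.τ₁); infer_instance
  exact quasiIso_map_of_shortExact g' (t₁.map_of_exact (HomologicalComplex.single C (.up ℤ) 0))
    (t₂.map_of_exact (HomologicalComplex.single C (.up ℤ) 0))

end HomologicalAlgebra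

/-! ### Homotopy commutative squares and K-injective complexes -/

section HomologicalAlgebra

open CochainComplex CochainComplex.mappingCone HomComplex

variable {C : Type*} [Category* C] [Abelian C]

lemma mapOfHomotopy_f_eq {K₁ L₁ K₂ L₂ : CochainComplex C ℤ} {φ₁ : K₁ ⟶ L₁} {φ₂ : K₂ ⟶ L₂}
    {a : K₁ ⟶ K₂} {b : L₁ ⟶ L₂} (h : Homotopy (φ₁ ≫ b) (a ≫ φ₂)) (p q : ℤ) (hpq : p + (-1) = q) :
    (inl φ₁).v p q hpq ≫ (mapOfHomotopy h).f q =
      a.f p ≫ (inl φ₂).v p q hpq + h.hom p q ≫ (inr φ₂).f q := by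
  refine (inl_v_desc_f φ₁ _ _ _ _ _ _).trans ?_
  simp [Cochain.equivHomotopy, Cochain.ofHomotopy]

lemma inr_mapOfHomotopy_f {K₁ L₁ K₂ L₂ : CochainComplex C ℤ} {φ₁ : K₁ ⟶ L₁} {φ₂ : K₂ ⟶ L₂}
    {a : K₁ ⟶ K₂} {b : L₁ ⟶ L₂} (h : Homotopy (φ₁ ≫ b) (a ≫ φ₂)) (p : ℤ) :
    (inr φ₁).f p ≫ (mapOfHomotopy h).f p = b.f p ≫ (inr φ₂).f p := by
  refine (inr_f_desc_f φ₁ _ _ _ _).trans ?_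
  simp

/-- Pasting of two homotopy commutative squares, the outer ones being strictly commutative and
the homotopies matching up. -/
lemma map_comp_mapOfHomotopy {K₁ L₁ K₂ L₂ K₃ L₃ K₄ L₄ : CochainComplex C ℤ} {φ₁ : K₁ ⟶ L₁}
    {φ₂ : K₂ ⟶ L₂} {φ₃ : K₃ ⟶ L₃} {φ₄ : K₄ ⟶ L₄} {a : K₁ ⟶ K₂} {b : L₁ ⟶ L₂} {a' : K₂ ⟶ K₄}
    {b' : L₂ ⟶ L₄} {c : K₁ ⟶ K₃} {d : L₁ ⟶ L₃} {c' : K₃ ⟶ K₄} {d' : L₃ ⟶ L₄}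
    (e : φ₁ ≫ b = a ≫ φ₂) (e' : φ₃ ≫ d' = c' ≫ φ₄)
    (h : Homotopy (φ₂ ≫ b') (a' ≫ φ₄)) (h' : Homotopy (φ₁ ≫ d) (c ≫ φ₃))
    (ha : a ≫ a' = c ≫ c') (hb : b ≫ b' = d ≫ d')
    (hh : ∀ p q : ℤ, p + (-1) = q → a.f p ≫ h.hom p q = h'.hom p q ≫ d'.f q) :
    mappingCone.map φ₁ φ₂ a b e ≫ mapOfHomotopy h =
      mapOfHomotopy h' ≫ mappingCone.map φ₃ φ₄ c' d' e' := by
  rw [map_eq_mapOfHomotopy, map_eq_mapOfHomotopy]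
  ext n
  have hn : n + 1 + (-1) = n := by lia
  have h₁ (p q : ℤ) : (Homotopy.ofEq e).hom p q = 0 := rfl
  have h₂ (p q : ℤ) : (Homotopy.ofEq e').hom p q = 0 := rfl
  have ha' := congr_arg (fun f => f.f (n + 1)) ha
  have hb' := congr_arg (fun f => f.f n) hb
  simp only [HomologicalComplex.comp_f] at ha' hb'
  apply ext_from _ (n + 1) n rfl
  · rw [HomologicalComplex.comp_f, HomologicalComplex.comp_f, ← Category.assoc, ← Category.assoc,
      mapOfHomotopy_f_eq, mapOfHomotopy_f_eq, h₁, zero_comp, add_zero, Preadditive.add_comp,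
      Category.assoc, mapOfHomotopy_f_eq, Category.assoc, mapOfHomotopy_f_eq, Category.assoc,
      inr_mapOfHomotopy_f, h₂, zero_comp, add_zero, Preadditive.comp_add, reassoc_of% ha',
      ← Category.assoc (a.f _) (h.hom _ _), hh _ _ hn, Category.assoc]
  · rw [HomologicalComplex.comp_f, HomologicalComplex.comp_f, ← Category.assoc, ← Category.assoc,
      inr_mapOfHomotopy_f, inr_mapOfHomotopy_f, Category.assoc, Category.assoc,
      inr_mapOfHomotopy_f, inr_mapOfHomotopy_f, reassoc_of% hb']

/-- If a homotopy commutative square of complexes is resolved by a commutative square of objects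
such that the horizontal maps are epimorphisms with isomorphic kernels, then it induces a
quasi-isomorphism of mapping cones. -/
lemma quasiIso_mapOfHomotopy_of_isIso_kernel {F E G H : C} (φ : F ⟶ E) (ψ : G ⟶ H) (a : F ⟶ G)
    (b : E ⟶ H) (comm : φ ≫ b = a ≫ ψ) [Epi φ] [Epi ψ] [IsIso (kernel.map φ ψ a b comm)]
    {KF KE KG KH : CochainComplex C ℤ} [KH.IsStrictlyGE 0]
    (rF : (singleFunctor C 0).obj F ⟶ KF) (rE : (singleFunctor C 0).obj E ⟶ KE)
    (rG : (singleFunctor C 0).obj G ⟶ KG) (rH : (singleFunctor C 0).obj H ⟶ KH)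
    [QuasiIso rF] [QuasiIso rE] [QuasiIso rG] [QuasiIso rH]
    {t : KF ⟶ KE} {t' : KG ⟶ KH} {l : KF ⟶ KG} {r : KE ⟶ KH}
    (ht : rF ≫ t = (singleFunctor C 0).map φ ≫ rE) (ht' : rG ≫ t' = (singleFunctor C 0).map ψ ≫ rH)
    (hl : rF ≫ l = (singleFunctor C 0).map a ≫ rG) (hr : rE ≫ r = (singleFunctor C 0).map b ≫ rH)
    (h : Homotopy (t ≫ r) (l ≫ t')) :
    QuasiIso (mapOfHomotopy h) := by
  have q₁ := quasiIso_mappingCone_map _ _ _ _ ht.symm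
  have q₂ := quasiIso_mappingCone_map _ _ _ _ ht'.symm
  have q₃ := quasiIso_map_single_of_isIso_kernel φ ψ a b comm
  have e := map_comp_mapOfHomotopy ht.symm ht'.symm h
    (Homotopy.ofEq (by rw [← Functor.map_comp, ← Functor.map_comp, comm])) hl hr (by
      intro p q hpq
      refine Eq.trans ?_ zero_comp.symm
      -- The source is concentrated in degree `0`, and `KH` vanishes in degree `-1`. The composite
      -- of `rF` with the given homotopy is thus zero in all degrees, and the homotopies match.
      by_cases hp : p = 0
      · exact (KH.isZero_of_isStrictlyGE 0 q (by lia)).eq_of_tgt _ _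
      · exact (HomologicalComplex.isZero_single_obj_X (.up ℤ) 0 F p hp).eq_of_src _ _)
  rw [← map_eq_mapOfHomotopy] at e
  have : QuasiIso (mappingCone.map _ _ _ _ ht.symm ≫ mapOfHomotopy h) := by
    rw [e]; infer_instance
  exact quasiIso_of_comp_left (mappingCone.map _ _ _ _ ht.symm) _

variable {D : Type*} [Category* D] [Abelian D]

/-- A quasi-isomorphism between K-injective complexes is a homotopy equivalence, which any additive
functor preserves; no exactness of `Γ` is involved. -/
lemma quasiIso_map_of_isKInjective (Γ : C ⥤ D) [Γ.Additive] {K L : CochainComplex C ℤ}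
    [K.IsKInjective] [L.IsKInjective] (f : K ⟶ L) [QuasiIso f] :
    QuasiIso ((Γ.mapHomologicalComplex (.up ℤ)).map f) := by
  obtain ⟨e, rfl⟩ := (CochainComplex.IsKInjective.quasiIso_iff f).1 inferInstance
  exact inferInstanceAs (QuasiIso (Γ.mapHomotopyEquiv e).hom)

/-- K-injectivity is orthogonality to the acyclic complexes in the homotopy category, a condition
stable under cones. -/
instance isKInjective_mappingCone {K L : CochainComplex C ℤ} (φ : K ⟶ L) [K.IsKInjective]
    [L.IsKInjective] : (mappingCone φ).IsKInjective := by
  rw [CochainComplex.isKInjective_iff_rightOrthogonal]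
  exact ObjectProperty.ext_of_isTriangulatedClosed₃ _ _
    (HomotopyCategory.mappingCone_triangleh_distinguished φ)
    (CochainComplex.IsKInjective.rightOrthogonal K) (CochainComplex.IsKInjective.rightOrthogonal L)

lemma inl_mapHomologicalComplexIso_inv (Γ : C ⥤ D) [Γ.Additive] {K L : CochainComplex C ℤ}
    (φ : K ⟶ L) (n : ℤ) :
    (inl ((Γ.mapHomologicalComplex (.up ℤ)).map φ)).v (n + 1) n (by lia) ≫
      (mapHomologicalComplexIso φ Γ).inv.f n = Γ.map ((inl φ).v (n + 1) n (by lia)) := by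
  have key {W X Z T : D} {i : W ⟶ X} {f : X ⟶ W} {g : W ⟶ T} {h : X ⟶ Z} {k : Z ⟶ T}
      (hf : i ≫ f = 𝟙 W) (hh : i ≫ h = 0) : i ≫ (f ≫ g + h ≫ k) = g := by
    rw [Preadditive.comp_add, reassoc_of% hf, reassoc_of% hh, zero_comp, add_zero]
  exact key (inl_v_fst_v _ _ _ _) (inl_v_snd_v _ _ _ _)

lemma inr_mapHomologicalComplexIso_inv (Γ : C ⥤ D) [Γ.Additive] {K L : CochainComplex C ℤ}
    (φ : K ⟶ L) (n : ℤ) :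
    (inr ((Γ.mapHomologicalComplex (.up ℤ)).map φ)).f n ≫
      (mapHomologicalComplexIso φ Γ).inv.f n = Γ.map ((inr φ).f n) := by
  have key {W X Z T : D} {i : W ⟶ X} {f : X ⟶ Z} {g : Z ⟶ T} {h : X ⟶ W} {k : W ⟶ T}
      (hf : i ≫ f = 0) (hh : i ≫ h = 𝟙 W) : i ≫ (f ≫ g + h ≫ k) = k := by
    rw [Preadditive.comp_add, reassoc_of% hf, reassoc_of% hh, zero_comp, zero_add]
  exact key (inr_f_fst_v _ _ _ _) (inr_f_snd_v _ _)

/-- Allows a quasi-isomorphism of cones of sheaf complexes to be transported to the cones of their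
global sections. -/
lemma mapHomologicalComplexIso_inv_comp_map_mapOfHomotopy (Γ : C ⥤ D) [Γ.Additive]
    {K₁ L₁ K₂ L₂ : CochainComplex C ℤ} {φ₁ : K₁ ⟶ L₁} {φ₂ : K₂ ⟶ L₂} {a : K₁ ⟶ K₂} {b : L₁ ⟶ L₂}
    (h : Homotopy (φ₁ ≫ b) (a ≫ φ₂))
    (h' : Homotopy ((Γ.mapHomologicalComplex (.up ℤ)).map φ₁ ≫ (Γ.mapHomologicalComplex _).map b)
      ((Γ.mapHomologicalComplex _).map a ≫ (Γ.mapHomologicalComplex _).map φ₂))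
    (hh : ∀ p q : ℤ, p + (-1) = q → h'.hom p q = Γ.map (h.hom p q)) :
    (mapHomologicalComplexIso φ₁ Γ).inv ≫ (Γ.mapHomologicalComplex (.up ℤ)).map (mapOfHomotopy h) =
      mapOfHomotopy h' ≫ (mapHomologicalComplexIso φ₂ Γ).inv := by
  ext n
  have hn : n + 1 + (-1) = n := by lia
  apply ext_from _ (n + 1) n rfl
  · rw [HomologicalComplex.comp_f, HomologicalComplex.comp_f, ← Category.assoc, ← Category.assoc,
      mapOfHomotopy_f_eq, inl_mapHomologicalComplexIso_inv, Preadditive.add_comp, Category.assoc,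
      inl_mapHomologicalComplexIso_inv, Category.assoc, inr_mapHomologicalComplexIso_inv, hh _ _ hn]
    refine (Γ.map_comp _ _).symm.trans ?_
    rw [mapOfHomotopy_f_eq, Γ.map_add, Γ.map_comp, Γ.map_comp]
    rfl
  · rw [HomologicalComplex.comp_f, HomologicalComplex.comp_f, ← Category.assoc, ← Category.assoc,
      inr_mapOfHomotopy_f, inr_mapHomologicalComplexIso_inv, Category.assoc,
      inr_mapHomologicalComplexIso_inv]
    refine (Γ.map_comp _ _).symm.trans ?_
    rw [inr_mapOfHomotopy_f, Γ.map_comp]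
    rfl

-- Maps into a K-injective complex up to homotopy are the same as maps in the derived category,
-- where `s` is invertible.
attribute [local instance] HasDerivedCategory.standard in
lemma nonempty_homotopy_of_isKInjective {M K L : CochainComplex C ℤ} [L.IsKInjective]
    (s : M ⟶ K) [QuasiIso s] {β β' : K ⟶ L} (h : s ≫ β = s ≫ β') : Nonempty (Homotopy β β') := by
  refine ⟨HomotopyCategory.homotopyOfEq _ _
    ((CochainComplex.IsKInjective.Qh_map_bijective _ _).injective ?_)⟩
  change DerivedCategory.Qh.map ((HomotopyCategory.quotient C (.up ℤ)).map β) =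
    DerivedCategory.Qh.map ((HomotopyCategory.quotient C (.up ℤ)).map β')
  have : IsIso (DerivedCategory.Qh.map ((HomotopyCategory.quotient C (.up ℤ)).map s)) :=
    inferInstanceAs (IsIso (DerivedCategory.Q.map s))
  rw [← cancel_epi (DerivedCategory.Qh.map ((HomotopyCategory.quotient C (.up ℤ)).map s)),
    ← Functor.map_comp, ← Functor.map_comp, ← Functor.map_comp, ← Functor.map_comp, h]

-- The lift exists up to homotopy because `s` is invertible in the derived category. The degree
-- bounds then leave no room for a homotopy, so the equality is strict.
attribute [local instance] HasDerivedCategory.standard in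
lemma exists_lift_of_isKInjective {F : C} {K L : CochainComplex C ℤ} [L.IsKInjective]
    [L.IsStrictlyGE 0] (s : (singleFunctor C 0).obj F ⟶ K) [QuasiIso s]
    (α : (singleFunctor C 0).obj F ⟶ L) : ∃ β : K ⟶ L, s ≫ β = α := by
  have : IsIso (DerivedCategory.Qh.map ((HomotopyCategory.quotient C (.up ℤ)).map s)) :=
    inferInstanceAs (IsIso (DerivedCategory.Q.map s))
  obtain ⟨γ, hγ⟩ := (CochainComplex.IsKInjective.Qh_map_bijective
    ((HomotopyCategory.quotient C (.up ℤ)).obj K) L).surjective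
    (inv (DerivedCategory.Qh.map ((HomotopyCategory.quotient C (.up ℤ)).map s)) ≫
      DerivedCategory.Qh.map ((HomotopyCategory.quotient C (.up ℤ)).map α))
  obtain ⟨β, rfl⟩ := (HomotopyCategory.quotient C (.up ℤ)).map_surjective γ
  refine ⟨β, ?_⟩
  have h : (HomotopyCategory.quotient C (.up ℤ)).map (s ≫ β) =
      (HomotopyCategory.quotient C (.up ℤ)).map α := by
    apply (CochainComplex.IsKInjective.Qh_map_bijective _ _).injective
    rw [Functor.map_comp, Functor.map_comp, hγ, IsIso.hom_inv_id_assoc]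
  have H := HomotopyCategory.homotopyOfEq _ _ h
  apply HomologicalComplex.from_single_hom_ext
  -- Both terms of the homotopy that contribute in degree `0` vanish: one lands in `L` in degree
  -- `-1`, the other starts from the single complex in degree `1`.
  have h₁ : H.hom 0 (-1) = 0 := (L.isZero_of_isStrictlyGE 0 (-1) (by lia)).eq_of_tgt _ _
  have h₂ : H.hom 1 0 = 0 :=
    (HomologicalComplex.isZero_single_obj_X (.up ℤ) 0 F 1 (by lia)).eq_of_src _ _
  rw [H.comm 0, dNext_eq _ (show (ComplexShape.up ℤ).Rel 0 1 by simp),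
    prevD_eq _ (show (ComplexShape.up ℤ).Rel (-1) 0 by simp), h₁, h₂]
  simp
  rfl

end HomologicalAlgebra

/-! ### From a square of sheaves to a cartesian square of derived global sections -/

section Square

open CochainComplex CochainComplex.mappingCone HomComplex

variable {C : Type*} [Category* C] [Abelian C] {D : Type*} [Category* D] [Abelian D]

lemma quasiIso_comp_of_isIso {K L M : CochainComplex C ℤ} (u : K ⟶ L) (v : L ⟶ M) (hu : IsIso u)
    (hv : QuasiIso v) : QuasiIso (u ≫ v) :=
  inferInstance

lemma quasiIso_mappingCone_map_of_isIso {K₁ L₁ K₂ L₂ : CochainComplex C ℤ} (φ₁ : K₁ ⟶ L₁)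
    (φ₂ : K₂ ⟶ L₂) (a : K₁ ⟶ K₂) (b : L₁ ⟶ L₂) (comm : φ₁ ≫ b = a ≫ φ₂) (ha : IsIso a)
    (hb : IsIso b) : QuasiIso (mappingCone.map φ₁ φ₂ a b comm) :=
  quasiIso_mappingCone_map _ _ _ _ _

/-- The degree zero part of an object considered as a complex. -/
def singleXZero (F : C) : ((singleFunctor C 0).obj F).X 0 ≅ F :=
  HomologicalComplex.singleObjXSelf (.up ℤ) 0 F

lemma ι'_f_zero_eq_augmentation {F : C} (I : InjectiveResolution F) :
    I.ι'.f 0 = (singleXZero F).hom ≫ augmentation I :=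
  (Iso.hom_inv_id_assoc (singleXZero F) _).symm

instance isKInjective_cochainComplex {F : C} (I : InjectiveResolution F) :
    I.cochainComplex.IsKInjective := isKInjective_of_injective _ 0

lemma isStrictlyGE_mapHomologicalComplex (Φ : C ⥤ D) [Φ.Additive] (K : CochainComplex C ℤ) (n : ℤ)
    [K.IsStrictlyGE n] : CochainComplex.IsStrictlyGE ((Φ.mapHomologicalComplex (.up ℤ)).obj K) n := by
  rw [isStrictlyGE_iff]
  exact fun i hi => Φ.map_isZero (K.isZero_of_isStrictlyGE n i hi)

instance isStrictlyGE_map_cochainComplex (Φ : C ⥤ D) [Φ.Additive] {F : C}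
    (I : InjectiveResolution F) :
    CochainComplex.IsStrictlyGE ((Φ.mapHomologicalComplex (.up ℤ)).obj I.cochainComplex) 0 :=
  isStrictlyGE_mapHomologicalComplex _ _ _

instance isKInjective_map_cochainComplex (Φ : C ⥤ D) [Φ.Additive] [Φ.PreservesInjectiveObjects]
    {F : C} (I : InjectiveResolution F) :
    CochainComplex.IsKInjective ((Φ.mapHomologicalComplex (.up ℤ)).obj I.cochainComplex) := by
  have (n : ℤ) : Injective (((Φ.mapHomologicalComplex (.up ℤ)).obj I.cochainComplex).X n) :=
    inferInstanceAs (Injective (Φ.obj (I.cochainComplex.X n)))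
  exact isKInjective_of_injective _ 0

/-- The map from `Φ(F)`, in degree zero, to the image under `Φ` of a resolution of `F`. -/
def mapι' (Φ : C ⥤ D) [Φ.Additive] {F : C} (I : InjectiveResolution F) :
    (singleFunctor D 0).obj (Φ.obj F) ⟶ (Φ.mapHomologicalComplex (.up ℤ)).obj I.cochainComplex :=
  (HomologicalComplex.singleMapHomologicalComplex Φ (.up ℤ) 0).inv.app F ≫
    (Φ.mapHomologicalComplex _).map I.ι'

lemma mapι'_f_zero (Φ : C ⥤ D) [Φ.Additive] {F : C} (I : InjectiveResolution F) :
    (mapι' Φ I).f 0 =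
      (singleXZero (Φ.obj F)).hom ≫ Φ.map (augmentation I) := by
  refine (congr_arg (· ≫ Φ.map (I.ι'.f 0))
    (HomologicalComplex.singleMapHomologicalComplex_inv_app_self Φ (.up ℤ) 0 F)).trans ?_
  refine (Category.assoc _ _ _).trans ?_
  exact congr_arg ((singleXZero (Φ.obj F)).hom ≫ ·)
    (Φ.map_comp (singleXZero F).inv (I.ι'.f 0)).symm

/-- An exact functor carries a resolution of `F` to a resolution of `Φ(F)`. For `Φ = i_*` this says
that `i_*` needs no deriving. -/
instance quasiIso_mapι' (Φ : C ⥤ D) [Φ.Additive] [Φ.PreservesHomology] {F : C}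
    (I : InjectiveResolution F) : QuasiIso (mapι' Φ I) := by
  have h : QuasiIso ((Φ.mapHomologicalComplex (.up ℤ)).map I.ι') := inferInstance
  have : IsIso ((HomologicalComplex.singleMapHomologicalComplex Φ (.up ℤ) 0).inv.app F) :=
    inferInstance
  exact quasiIso_comp_of_isIso _ _ this h

lemma single_map_f_zero {F G : C} (φ : F ⟶ G) : ((singleFunctor C 0).map φ).f 0 =
    (singleXZero F).hom ≫ φ ≫ (singleXZero G).inv :=
  HomologicalComplex.single_map_f_self (.up ℤ) 0 φ

/-- Translates the degree-zero compatibilities recorded in `RGammaSquare` into commutative squares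
of complexes; a map out of a complex concentrated in degree zero is determined by its component
there. -/
lemma ι'_comp_eq_iff {F G : C} (I : InjectiveResolution F) {L : CochainComplex C ℤ}
    (s : (singleFunctor C 0).obj G ⟶ L) (g : G ⟶ L.X 0)
    (hs : s.f 0 = (singleXZero G).hom ≫ g)
    (φ : F ⟶ G) (β : I.cochainComplex ⟶ L) :
    I.ι' ≫ β = (singleFunctor C 0).map φ ≫ s ↔ augmentation I ≫ β.f 0 = φ ≫ g := by
  have h₁ : (I.ι' ≫ β).f 0 = (singleXZero F).hom ≫
      augmentation I ≫ β.f 0 := by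
    rw [HomologicalComplex.comp_f, ι'_f_zero_eq_augmentation, Category.assoc]
  have h₂ : ((singleFunctor C 0).map φ ≫ s).f 0 =
      (singleXZero F).hom ≫ φ ≫ g := by
    rw [HomologicalComplex.comp_f, single_map_f_zero, hs]
    simp
  rw [← cancel_epi (singleXZero F).hom, ← h₁, ← h₂]
  exact ⟨fun h => congr_arg (fun f => f.f 0) h, fun h => HomologicalComplex.from_single_hom_ext h⟩

variable {Z Y : Scheme.{u}} {f : Z ⟶ Y}
  {F G : Sheaf Y.smallEtaleTopology AddCommGrpCat.{u}}
  {E H : Sheaf Z.smallEtaleTopology AddCommGrpCat.{u}}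
  {φ : F ⟶ (pushforward f).obj E} {ψ : G ⟶ (pushforward f).obj H} {a : F ⟶ G} {b : E ⟶ H}

lemma map_mapι' (Φ : C ⥤ D) [Φ.Additive] {E H : C} (I : InjectiveResolution E)
    (J : InjectiveResolution H) (b : E ⟶ H) (r : I.cochainComplex ⟶ J.cochainComplex)
    (h : I.ι' ≫ r = (singleFunctor C 0).map b ≫ J.ι') :
    mapι' Φ I ≫ (Φ.mapHomologicalComplex (.up ℤ)).map r =
      (singleFunctor D 0).map (Φ.map b) ≫ mapι' Φ J := by
  have h' := congr_arg (fun k => (Φ.mapHomologicalComplex (.up ℤ)).map k) h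
  simp only [Functor.map_comp] at h'
  refine (Category.assoc _ _ _).trans ?_
  refine (congr_arg (_ ≫ ·) h').trans ?_
  refine (Category.assoc _ _ _).symm.trans ?_
  refine (congr_arg (· ≫ _)
    ((HomologicalComplex.singleMapHomologicalComplex Φ (.up ℤ) 0).inv.naturality b).symm).trans ?_
  exact Category.assoc _ _ _

namespace RGammaSquare

/-- All four lifts map into K-injective complexes, the push-forwards included because `f_*`
preserves injectives. The two composites agree on `F`, hence are homotopic. -/
lemma nonempty_of_comm [(pushforward f).PreservesHomology]
    [(pushforward f).PreservesInjectiveObjects] (comm : φ ≫ (pushforward f).map b = a ≫ ψ) :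
    Nonempty (RGammaSquare f φ ψ a b) := by
  obtain ⟨t, ht⟩ := exists_lift_of_isKInjective (injectiveResolution F).ι'
    ((singleFunctor _ 0).map φ ≫ mapι' (pushforward f) (injectiveResolution E))
  obtain ⟨t', ht'⟩ := exists_lift_of_isKInjective (injectiveResolution G).ι'
    ((singleFunctor _ 0).map ψ ≫ mapι' (pushforward f) (injectiveResolution H))
  obtain ⟨l, hl⟩ := exists_lift_of_isKInjective (injectiveResolution F).ι'
    ((singleFunctor _ 0).map a ≫ (injectiveResolution G).ι')
  obtain ⟨r, hr⟩ := exists_lift_of_isKInjective (injectiveResolution E).ι'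
    ((singleFunctor _ 0).map b ≫ (injectiveResolution H).ι')
  have hr' := map_mapι' (pushforward f) _ _ _ _ hr
  obtain ⟨h⟩ := nonempty_homotopy_of_isKInjective (injectiveResolution F).ι'
    (β := t ≫ ((pushforward f).mapHomologicalComplex _).map r) (β' := l ≫ t') (by
      rw [reassoc_of% ht, hr', reassoc_of% hl, ht', ← Functor.map_comp_assoc, comm,
        Functor.map_comp_assoc])
  exact ⟨⟨_, _, _, _, t, (ι'_comp_eq_iff _ _ _ (mapι'_f_zero _ _) _ _).1 ht,
    t', (ι'_comp_eq_iff _ _ _ (mapι'_f_zero _ _) _ _).1 ht',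
    l, (ι'_comp_eq_iff _ _ _ (ι'_f_zero_eq_augmentation _) _ _).1 hl,
    r, (ι'_comp_eq_iff _ _ _ (ι'_f_zero_eq_augmentation _) _ _).1 hr, h⟩⟩

instance isIso_etaleTopComparison (f : Z ⟶ Y) : IsIso (etaleTopComparison f) := by
  refine ⟨ehomMk (pullback.snd (𝟙 Y) f) (Category.comp_id _), ehom_ext ?_, ehom_ext ?_⟩
  · exact pullback.lift_snd _ _ _
  · refine pullback.hom_ext (f := 𝟙 Y) (g := f) ?_ ?_
    · refine (Category.assoc _ _ _).trans ?_
      refine (congr_arg (pullback.snd (𝟙 Y) f ≫ ·) (pullback.lift_fst _ _ _)).trans ?_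
      refine pullback.condition.symm.trans ?_
      exact (Category.comp_id _).trans (Category.id_comp _).symm
    · refine (Category.assoc _ _ _).trans ?_
      refine (congr_arg (pullback.snd (𝟙 Y) f ≫ ·) (pullback.lift_snd _ _ _)).trans ?_
      exact (Category.comp_id _).trans (Category.id_comp _).symm

instance isIso_RGammaPushforward (f : Z ⟶ Y) {E : Sheaf Z.smallEtaleTopology AddCommGrpCat.{u}}
    (I : InjectiveResolution E) : IsIso (RGammaPushforward f I) := by
  have (n : ℤ) : IsIso ((RGammaPushforward f I).f n) :=
    inferInstanceAs (IsIso ((I.cochainComplex.X n).obj.map (etaleTopComparison f).op))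
  exact HomologicalComplex.Hom.isIso_of_components _

/-- The cone map is already a quasi-isomorphism at the level of sheaves on `Y`. Its source and
target are K-injective, so taking global sections preserves this; finally `Γ(Y, f_* I)` is
identified with `Γ(Z, I)`. -/
theorem isCartesian_of_isIso_kernel [(pushforward f).PreservesHomology]
    [(pushforward f).PreservesInjectiveObjects] (comm : φ ≫ (pushforward f).map b = a ≫ ψ)
    [Epi φ] [Epi ψ] [IsIso (kernel.map φ ψ a ((pushforward f).map b) comm)]
    (S : RGammaSquare f φ ψ a b) : S.IsCartesian := by
  have hr := (ι'_comp_eq_iff _ _ _ (ι'_f_zero_eq_augmentation _) _ _).2 S.right_comm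
  have q : QuasiIso (mapOfHomotopy S.homotopy) :=
    quasiIso_mapOfHomotopy_of_isIso_kernel φ ψ a ((pushforward f).map b) comm
      S.resF.ι' (mapι' (pushforward f) S.resE) S.resG.ι' (mapι' (pushforward f) S.resH)
      ((ι'_comp_eq_iff _ _ _ (mapι'_f_zero _ _) _ _).2 S.top_comm)
      ((ι'_comp_eq_iff _ _ _ (mapι'_f_zero _ _) _ _).2 S.bottom_comm)
      ((ι'_comp_eq_iff _ _ _ (ι'_f_zero_eq_augmentation _) _ _).2 S.left_comm)
      (map_mapι' _ _ _ _ _ hr) _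
  let Γ := (globalSections Y).mapHomologicalComplex (.up ℤ)
  let h' : Homotopy (Γ.map S.top ≫ Γ.map (((pushforward f).mapHomologicalComplex _).map S.right))
      (Γ.map S.left ≫ Γ.map S.bottom) :=
    (Homotopy.ofEq (Γ.map_comp _ _).symm).trans
      (((globalSections Y).mapHomotopy S.homotopy).trans (Homotopy.ofEq (Γ.map_comp _ _)))
  have hh' (p q : ℤ) : h'.hom p q = (globalSections Y).map (S.homotopy.hom p q) :=
    (zero_add _).trans (add_zero _)
  have q' : QuasiIso (mapOfHomotopy h') := by
    have e := mapHomologicalComplexIso_inv_comp_map_mapOfHomotopy (globalSections Y) S.homotopy h'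
      fun p q _ => hh' p q
    have q₁ := quasiIso_map_of_isKInjective (globalSections Y) (mapOfHomotopy S.homotopy)
    have q₂ : QuasiIso (mapOfHomotopy h' ≫
        (mapHomologicalComplexIso S.bottom (globalSections Y)).inv) := by
      rw [← e]
      exact quasiIso_comp _ _
    exact quasiIso_of_comp_right _ (mapHomologicalComplexIso S.bottom (globalSections Y)).inv
  -- Compares the cones over `Γ(Y, f_* I)` with those over `Γ(Z, I)`; both vertical comparisons are
  -- isomorphisms, so the quasi-isomorphism passes from `h'` to `S.homotopyMap`.
  have e := map_comp_mapOfHomotopy (φ₁ := Γ.map S.top) (φ₂ := S.topMap) (φ₃ := Γ.map S.bottom)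
    (φ₄ := S.bottomMap) (a := 𝟙 _) (b := RGammaPushforward f S.resE) (c' := 𝟙 _)
    (d' := RGammaPushforward f S.resH) (Category.id_comp _).symm (Category.id_comp _).symm
    S.homotopyMap h' ((Category.id_comp _).trans (Category.comp_id _).symm)
    ((NatTrans.mapHomologicalComplex (globalSectionsPushforward f) (.up ℤ)).naturality
      S.right).symm (by
      intro p q _
      refine (Category.id_comp _).trans ?_
      rw [hh']
      exact (zero_add _).trans (add_zero _))
  have q₁ := quasiIso_mappingCone_map_of_isIso (Γ.map S.top) S.topMap (𝟙 _)
    (RGammaPushforward f S.resE) (Category.id_comp _).symm (IsIso.id _) inferInstance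
  have q₂ := quasiIso_mappingCone_map_of_isIso (Γ.map S.bottom) S.bottomMap (𝟙 _)
    (RGammaPushforward f S.resH) (Category.id_comp _).symm (IsIso.id _) inferInstance
  have q₃ : QuasiIso (mappingCone.map (Γ.map S.top) S.topMap (𝟙 _) (RGammaPushforward f S.resE)
    (Category.id_comp _).symm ≫ mapOfHomotopy S.homotopyMap) := by
    rw [e]
    exact quasiIso_comp _ _
  exact quasiIso_of_comp_left (mappingCone.map (Γ.map S.top) S.topMap (𝟙 _)
    (RGammaPushforward f S.resE) (Category.id_comp _).symm) _

end RGammaSquare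

end Square

/-! ### Lifting étale algebras along surjections -/

section StandardEtale

open Polynomial TensorProduct

/-- Standard étale pairs which classify the same elements have isomorphic algebras. -/
def standardEtaleRingEquiv {R : Type*} [CommRing R] (P Q : StandardEtalePair R)
    (h : P.HasMap Q.X) (h' : Q.HasMap P.X) : P.Ring ≃ₐ[R] Q.Ring :=
  AlgEquiv.ofAlgHom (P.lift _ h) (Q.lift _ h') (Q.hom_ext (by simp)) (P.hom_ext (by simp))

/-- Standard étale algebras lift along surjections. -/
lemma exists_tensorProduct_equiv_of_isStandardEtale {A B C : Type*} [CommRing A] [CommRing B]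
    [Algebra A B] (h : Function.Surjective (algebraMap A B)) [CommRing C] [Algebra B C]
    [Algebra.IsStandardEtale B C] :
    ∃ P : StandardEtalePair A, Nonempty (B ⊗[A] P.Ring ≃ₐ[B] C) := by
  obtain ⟨P⟩ : Nonempty (StandardEtalePresentation B C) := inferInstance
  obtain ⟨F, hF, hd, hm⟩ := lifts_and_natDegree_eq_and_monic
    ((mem_lifts _).2 (map_surjective _ h P.f)) P.monic_f
  obtain ⟨G, hG⟩ := map_surjective _ h P.g
  -- For an arbitrary monic lift `F` the derivative need not be invertible where `G` is, so it is
  -- inverted as well. Over `B` this changes nothing, since the derivative of `P.f` is already a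
  -- unit in the standard étale algebra.
  let Q : StandardEtalePair A := ⟨F, hm, derivative F * G, G, 0, 1, by ring⟩
  have hg : (Q.map (algebraMap A B)).g = derivative P.f * P.g := by simp [Q, hG, ← hF]
  have hf : (Q.map (algebraMap A B)).f = P.f := hF
  let T : StandardEtalePresentation A Q.Ring :=
    ⟨Q, Q.X, Q.hasMap_X, by simpa [StandardEtalePair.lift_X_left] using Function.bijective_id⟩
  refine ⟨Q, ⟨(T.baseChange (T := B)).equivRing.trans
    ((standardEtaleRingEquiv (Q.map (algebraMap A B)) P.P ?_ ?_).trans P.equivRing.symm)⟩⟩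
  · refine ⟨by rw [hf]; exact P.P.hasMap_X.1, ?_⟩
    rw [hg, map_mul]
    exact P.P.hasMap_X.isUnit_derivative_f.mul P.P.hasMap_X.2
  · refine ⟨by rw [← hf]; exact (Q.map (algebraMap A B)).hasMap_X.1, ?_⟩
    have := (Q.map (algebraMap A B)).hasMap_X.2
    rw [hg, map_mul] at this
    exact isUnit_of_mul_isUnit_right this

/-- Étale algebras lift along surjections, locally around any prime. -/
lemma exists_isPushout_of_etale {A B C : CommRingCat.{u}} (π : A ⟶ B)
    (hπ : Function.Surjective π.hom) (φ : B ⟶ C) (hφ : φ.hom.Etale) (q : Spec C) :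
    ∃ (D C' : CommRingCat.{u}) (α : A ⟶ D) (δ : D ⟶ C') (c : C ⟶ C'),
      IsPushout π α (φ ≫ c) δ ∧ α.hom.Etale ∧ q ∈ Set.range (Spec.map c) := by
  let _ := π.hom.toAlgebra
  let _ := φ.hom.toAlgebra
  have : Algebra.Etale B C := hφ
  have : q.asIdeal.IsPrime := PrimeSpectrum.isPrime q
  obtain ⟨f, hf, hst⟩ := Algebra.IsEtaleAt.exists_isStandardEtale (R := B) q.asIdeal
  obtain ⟨P, ⟨e⟩⟩ := exists_tensorProduct_equiv_of_isStandardEtale (A := A) (B := B)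
    (C := Localization.Away f) hπ
  refine ⟨.of P.Ring, .of (Localization.Away f), CommRingCat.ofHom (algebraMap A P.Ring),
    CommRingCat.ofHom (e.toRingEquiv.toRingHom.comp Algebra.TensorProduct.includeRight.toRingHom),
    CommRingCat.ofHom (algebraMap C (Localization.Away f)), ?_, ?_, ?_⟩
  · refine (CommRingCat.isPushout_tensorProduct A B P.Ring).of_iso (.refl _) (.refl _) (.refl _)
      e.toRingEquiv.toCommRingCatIso ?_ ?_ ?_ ?_
    · exact (Category.comp_id _).trans (Category.id_comp _).symm
    · exact (Category.comp_id _).trans (Category.id_comp _).symm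
    · refine Eq.trans ?_ (Category.id_comp _).symm
      ext b
      exact e.commutes b
    · exact (Category.id_comp _).symm
  · exact (RingHom.etale_algebraMap (R := A) (S := P.Ring)).2 inferInstance
  · have := PrimeSpectrum.localization_away_comap_range (Localization.Away f) f
    have hq : q ∈ (PrimeSpectrum.basicOpen f : Set (PrimeSpectrum C)) := hf
    rw [← this] at hq
    exact hq

end StandardEtale

/-! ### Lifting étale morphisms along closed immersions -/

section EtaleLift

variable {Z Y X : Scheme.{u}}

/-- Étale morphisms lift along closed immersions, locally around any point. -/
lemma exists_isPullback_of_etale (i : Z ⟶ Y) [IsClosedImmersion i] (f : X ⟶ Z) [Etale f] (x : X) :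
    ∃ (V X' : Scheme.{u}) (p : V ⟶ Y) (k : X' ⟶ V) (j : X' ⟶ X),
      Etale p ∧ IsPullback k (j ≫ f) p i ∧ x ∈ Set.range j := by
  -- Reduction to rings: an affine neighbourhood `Spec A` of the image point meets `Z` in `Spec (A ⧸
  -- I)`, over which an affine neighbourhood `Spec C` of `x` is chosen.
  obtain ⟨A, a, ha, ⟨y, hy⟩, -⟩ := Scheme.exists_affine_mem_range_and_range_subset
    (X := Y) (x := i (f x)) (U := ⊤) trivial
  obtain ⟨I, e, he⟩ := (IsClosedImmersion.Spec_iff (f := pullback.snd i a)).1 inferInstance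
  let B : CommRingCat.{u} := .of (A ⧸ I)
  let π : A ⟶ B := CommRingCat.ofHom (Ideal.Quotient.mk I)
  let b : Spec B ⟶ Z := e.inv ≫ pullback.fst i a
  have hb : IsPullback (Spec.map π) b a i := by
    refine (IsPullback.of_hasPullback i a).flip.of_iso e (.refl _) (.refl _) (.refl _) ?_ ?_ ?_ ?_
    · exact (Category.comp_id _).trans he
    · exact (Category.comp_id _).trans (e.hom_inv_id_assoc _).symm
    · exact (Category.comp_id _).trans (Category.id_comp _).symm
    · exact (Category.comp_id _).trans (Category.id_comp _).symm
  have hbo : IsOpenImmersion b := MorphismProperty.of_isPullback hb ha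
  obtain ⟨z, hz⟩ : f x ∈ Set.range b := by
    obtain ⟨z, hz, -⟩ := Scheme.Pullback.exists_preimage_pullback (f := i) (g := a) (f x) y hy.symm
    exact ⟨e.hom z, by rw [← Scheme.Hom.comp_apply, Iso.hom_inv_id_assoc, hz]⟩
  obtain ⟨x₁, hx₁, -⟩ := Scheme.Pullback.exists_preimage_pullback (f := f) (g := b) x z hz.symm
  obtain ⟨C, c, hc, ⟨q, hq⟩, -⟩ := Scheme.exists_affine_mem_range_and_range_subset
    (X := pullback f b) (x := x₁) (U := ⊤) trivial
  obtain ⟨φ, hφ⟩ := Spec.map_surjective (c ≫ pullback.snd f b)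
  have hφe : φ.hom.Etale := by
    rw [← HasRingHomProperty.Spec_iff (P := @Etale), hφ]
    infer_instance
  obtain ⟨D, C', α, δ, c', hp, hα, hq'⟩ :=
    exists_isPushout_of_etale π Ideal.Quotient.mk_surjective φ hφe q
  have hαe : Etale (Spec.map α) := HasRingHomProperty.Spec_iff.2 hα
  refine ⟨Spec D, Spec C', Spec.map α ≫ a, Spec.map δ, Spec.map c' ≫ c ≫ pullback.fst f b,
    inferInstance, ?_, ?_⟩
  · have h₁ := (isPullback_SpecMap_of_isPushout _ _ _ _ hp).flip.paste_vert hb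
    have e₁ : (Spec.map c' ≫ c ≫ pullback.fst f b) ≫ f = Spec.map (φ ≫ c') ≫ b := by
      rw [Category.assoc, Category.assoc, pullback.condition, Spec.map_comp, hφ]
      simp only [Category.assoc]
    rw [e₁]
    exact h₁
  · obtain ⟨w, rfl⟩ := hq'
    exact ⟨w, by rw [Scheme.Hom.comp_apply, Scheme.Hom.comp_apply, hq, hx₁]⟩

end EtaleLift

/-! ### Covers of `U` and covers of `U ×_Y Z` -/

section Covers

variable {Y Z : Scheme.{u}}

lemma mem_smallEtaleTopology_iff {U : Y.Etale} (S : Sieve U) : S ∈ Y.smallEtaleTopology U ↔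
    ∀ x : esch U, ∃ (V : Y.Etale) (r : V ⟶ U), S r ∧ x ∈ Set.range (emap r) := by
  constructor
  · intro hS x
    obtain ⟨ι, V, g, rfl⟩ := S.exists_eq_ofArrows
    rw [Scheme.ofArrows_mem_smallEtaleTopology_iff] at hS
    obtain ⟨i, hi⟩ := Set.mem_iUnion.1 (Set.eq_univ_iff_forall.1 hS x)
    exact ⟨_, g i, Sieve.ofArrows_mk _ _ _, hi⟩
  · intro h
    choose V r hr hx using h
    refine Y.smallEtaleTopology.superset_covering (S := Sieve.ofArrows V r) ?_
      ((Scheme.ofArrows_mem_smallEtaleTopology_iff _).2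
        (Set.eq_univ_of_forall fun x => Set.mem_iUnion.2 ⟨x, hx x⟩))
    rw [Sieve.ofArrows, Sieve.generate_le_iff]
    rintro _ _ ⟨x⟩
    exact hr x

lemma bot_mem_smallEtaleTopology (U : Y.Etale) [h : IsEmpty (esch U)] :
    (⊥ : Sieve U) ∈ Y.smallEtaleTopology U :=
  (mem_smallEtaleTopology_iff _).2 fun x => (h.false x).elim

/-- An étale `Y`-scheme from an étale morphism to an étale `Y`-scheme. -/
def eover {U : Y.Etale} {V : Scheme.{u}} (p : V ⟶ esch U) [Etale p] : Y.Etale :=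
  Scheme.Etale.mk (p ≫ estr U)

/-- The morphism `p` as a morphism of the étale site. -/
def eoverHom {U : Y.Etale} {V : Scheme.{u}} (p : V ⟶ esch U) [Etale p] : eover p ⟶ U :=
  ehomMk p rfl

instance isClosedImmersion_etalePullbackFst (i : Z ⟶ Y) [IsClosedImmersion i] (U : Y.Etale) :
    IsClosedImmersion (etalePullbackFst i U) :=
  inferInstanceAs (IsClosedImmersion (pullback.fst (estr U) i))

/-- Étale `U ×_Y Z`-schemes lift to étale `U`-schemes, locally around any point. -/
lemma exists_etalePullback_hom (i : Z ⟶ Y) [IsClosedImmersion i] {U : Y.Etale} {X : Z.Etale}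
    (g : X ⟶ (etalePullback i).obj U) (x : esch X) :
    ∃ (V : Y.Etale) (r : V ⟶ U) (h : (etalePullback i).obj V ⟶ X),
      h ≫ g = (etalePullback i).map r ∧ x ∈ Set.range (emap h) := by
  obtain ⟨V, X', p, k, j, hp, H, hx⟩ := exists_isPullback_of_etale (etalePullbackFst i U) (emap g) x
  let e : esch ((etalePullback i).obj (eover p)) ≅ X' :=
    (etalePullback_map_isPullback i (eoverHom p)).flip.isoIsPullback _ _ H
  have he : e.hom ≫ j ≫ emap g = emap ((etalePullback i).map (eoverHom p)) :=
    IsPullback.isoIsPullback_hom_snd _ _ _ _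
  refine ⟨eover p, eoverHom p, ehomMk (e.hom ≫ j) ?_, ?_, ?_⟩
  · rw [← emap_w ((etalePullback i).map (eoverHom p)), ← he, ← emap_w g]
    simp only [Category.assoc]
  · apply ehom_ext
    rw [emap_comp, emap_ehomMk, Category.assoc, he]
  · rw [emap_ehomMk]
    obtain ⟨w, rfl⟩ := hx
    exact ⟨e.inv w, by rw [← Scheme.Hom.comp_apply, Iso.inv_hom_id_assoc]⟩

/-- The complement of `U ×_Y Z` in `U`. -/
def complOpens (i : Z ⟶ Y) [IsClosedImmersion i] (U : Y.Etale) : (esch U).Opens :=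
  ⟨(Set.range (etalePullbackFst i U))ᶜ,
    (etalePullbackFst i U).isClosedEmbedding.isClosed_range.isOpen_compl⟩

lemma isEmpty_esch_etalePullback_iff (i : Z ⟶ Y) (U : Y.Etale) :
    IsEmpty (esch ((etalePullback i).obj U)) ↔ Set.range (estr U) ⊆ (Set.range i)ᶜ := by
  constructor
  · rintro h _ ⟨x, rfl⟩ ⟨z, hz⟩
    obtain ⟨w, -, -⟩ := Scheme.Pullback.exists_preimage_pullback x z hz.symm
    exact h.false w
  · refine fun h => ⟨fun x => ?_⟩
    refine h ⟨etalePullbackFst i U x, rfl⟩ ⟨estr ((etalePullback i).obj U) x, ?_⟩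
    rw [← Scheme.Hom.comp_apply, ← Scheme.Hom.comp_apply, (etalePullback_isPullback i U).w]

lemma exists_complement (i : Z ⟶ Y) [IsClosedImmersion i] {U : Y.Etale} (x : esch U)
    (hx : x ∉ Set.range (etalePullbackFst i U)) :
    ∃ (V : Y.Etale) (r : V ⟶ U), IsEmpty (esch ((etalePullback i).obj V)) ∧
      x ∈ Set.range (emap r) := by
  refine ⟨eover (complOpens i U).ι, eoverHom _, ⟨fun w => ?_⟩, ?_⟩
  · have h₁ := (etalePullbackFst i (eover (complOpens i U).ι) w).2
    refine h₁ ⟨emap ((etalePullback i).map (eoverHom (complOpens i U).ι)) w, ?_⟩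
    rw [← Scheme.Hom.comp_apply, etalePullback_map_fst, Scheme.Hom.comp_apply]
    rfl
  · have h : x ∈ Set.range (complOpens i U).ι := by
      rw [Scheme.Opens.range_ι]
      exact hx
    exact h

/-- A cover of `U ×_Y Z`, together with the complement of `U ×_Y Z`, gives a cover of `U`. -/
lemma exists_cover_of_etalePullback (i : Z ⟶ Y) [IsClosedImmersion i] {U : Y.Etale}
    {P : ∀ ⦃V : Y.Etale⦄, (V ⟶ U) → Prop}
    (hP : ∀ ⦃V W : Y.Etale⦄ (r : V ⟶ U) (s : W ⟶ V), P r → P (s ≫ r))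
    (h₁ : ∀ (x : esch ((etalePullback i).obj U)), ∃ (V : Y.Etale) (r : V ⟶ U), P r ∧
      etalePullbackFst i U x ∈ Set.range (emap r))
    (h₂ : ∀ (V : Y.Etale) (r : V ⟶ U), IsEmpty (esch ((etalePullback i).obj V)) → P r) :
    ∃ S ∈ Y.smallEtaleTopology U, ∀ (V : Y.Etale) (r : V ⟶ U), S r → P r := by
  refine ⟨⟨fun V r => P r, fun h s => hP _ s h⟩, (mem_smallEtaleTopology_iff _).2 fun x => ?_,
    fun V r h => h⟩
  by_cases hx : x ∈ Set.range (etalePullbackFst i U)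
  · obtain ⟨w, rfl⟩ := hx
    exact h₁ w
  · obtain ⟨V, r, hV, hr⟩ := exists_complement i x hx
    exact ⟨V, r, h₂ V r hV, hr⟩

/-- The source of the exactness of `i_*`: covers of `U ×_Y Z` are refined by covers of `U`, up to
pieces missing `Z`, on which every sheaf pushed forward from `Z` has trivial sections. -/
lemma exists_cover_of_mem (i : Z ⟶ Y) [IsClosedImmersion i] {U : Y.Etale}
    {T : Sieve ((etalePullback i).obj U)} (hT : T ∈ Z.smallEtaleTopology _) :
    ∃ S ∈ Y.smallEtaleTopology U, ∀ (V : Y.Etale) (r : V ⟶ U), S r →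
      T ((etalePullback i).map r) ∨ IsEmpty (esch ((etalePullback i).obj V)) := by
  refine exists_cover_of_etalePullback i ?_ ?_ fun V r h => Or.inr h
  · rintro V W r s (h | h)
    · exact Or.inl (by rw [Functor.map_comp]; exact T.downward_closed h _)
    · exact Or.inr ⟨fun x => h.false (emap ((etalePullback i).map s) x)⟩
  · intro x
    obtain ⟨X, g, hg, w, rfl⟩ := (mem_smallEtaleTopology_iff _).1 hT x
    obtain ⟨V, r, h, e, v, rfl⟩ := exists_etalePullback_hom i g w
    refine ⟨V, r, Or.inl (by rw [← e]; exact T.downward_closed hg _), etalePullbackFst i V v, ?_⟩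
    rw [← Scheme.Hom.comp_apply, ← Scheme.Hom.comp_apply, ← Scheme.Hom.comp_apply,
      ← etalePullback_map_fst, ← e, emap_comp, Category.assoc]

end Covers

/-! ### Loci of invertibility and lifting of units -/

section Units

variable {Y Z : Scheme.{u}}

/-- The open subset of `U` where `t` is invertible. -/
def unitLocus {U : Y.Etale} (t : (structMonoid Y).obj (op U)) : (esch U).Opens :=
  Scheme.basicOpen (esch U) (U := ⊤) t

/-- The étale (open) subscheme of `U` where `t` is invertible. -/
def ebasicOpen {U : Y.Etale} (t : (structMonoid Y).obj (op U)) : Y.Etale :=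
  eover (unitLocus t).ι

/-- The inclusion of the locus where `t` is invertible. -/
def ebasicOpenHom {U : Y.Etale} (t : (structMonoid Y).obj (op U)) : ebasicOpen t ⟶ U :=
  eoverHom _

lemma isUnit_iff_basicOpen_eq_top {X : Scheme.{u}} (t : Γ(X, ⊤)) :
    IsUnit t ↔ X.basicOpen t = ⊤ := by
  refine ⟨fun h => X.basicOpen_of_isUnit h, fun h => ?_⟩
  have := X.toRingedSpace.isUnit_res_basicOpen t
  have e : X.toRingedSpace.basicOpen t = ⊤ := h
  have key : ∀ (W : X.Opens) (k : W ≤ ⊤), W = ⊤ → IsUnit (X.presheaf.map (homOfLE k).op t) →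
      IsUnit t := by
    rintro W k rfl h
    have : X.presheaf.map (homOfLE k).op t = t := by
      rw [Subsingleton.elim (homOfLE k) (𝟙 _), op_id, X.presheaf.map_id]
      rfl
    rwa [this] at h
  exact key _ _ e this

lemma isUnit_appTop_iff {X W : Scheme.{u}} (f : X ⟶ W) (t : Γ(W, ⊤)) :
    IsUnit (f.appTop t) ↔ Set.range f ⊆ W.basicOpen t := by
  rw [isUnit_iff_basicOpen_eq_top, ← Scheme.preimage_basicOpen_top, Set.range_subset_iff]
  exact ⟨fun h x => (h ▸ trivial : x ∈ f ⁻¹ᵁ W.basicOpen t), fun h => top_unique fun x _ => h x⟩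

lemma isUnit_map_iff {U V : Y.Etale} (g : V ⟶ U) (t : (structMonoid Y).obj (op U)) :
    IsUnit ((structMonoid Y).map g.op t) ↔
      Set.range (emap g) ⊆ unitLocus t :=
  isUnit_appTop_iff (emap g) t

lemma range_ebasicOpenHom {U : Y.Etale} (t : (structMonoid Y).obj (op U)) :
    Set.range (emap (ebasicOpenHom t)) = unitLocus t :=
  Scheme.Opens.range_ι _

lemma isUnit_map_ebasicOpenHom {U : Y.Etale} (t : (structMonoid Y).obj (op U)) :
    IsUnit ((structMonoid Y).map (ebasicOpenHom t).op t) :=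
  (isUnit_map_iff _ _).2 (range_ebasicOpenHom t).le

lemma exists_lift_of_range_subset {X W : Scheme.{u}} (O : X.Opens) (f : W ⟶ X)
    (h : Set.range f ⊆ O) : ∃ l : W ⟶ (O : Scheme.{u}), l ≫ O.ι = f :=
  ⟨IsOpenImmersion.lift O.ι f (by rwa [Scheme.Opens.range_ι]), IsOpenImmersion.lift_fac _ _ _⟩

/-- A morphism `W ⟶ U ×_Y Z` such that `t` is invertible on `W` factors through the locus where
`t` is invertible. -/
lemma exists_lift_ebasicOpen (i : Z ⟶ Y) {U : Y.Etale} (t : (structMonoid Y).obj (op U))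
    {W : Z.Etale} (g : W ⟶ (etalePullback i).obj U)
    (h : IsUnit ((structMonoid Z).map g.op ((structMap i).app (op U) t))) :
    ∃ g' : W ⟶ (etalePullback i).obj (ebasicOpen t),
      g' ≫ (etalePullback i).map (ebasicOpenHom t) = g := by
  have h' : Set.range (emap g ≫ etalePullbackFst i U) ⊆ unitLocus t := by
    refine (isUnit_appTop_iff (emap g ≫ etalePullbackFst i U) _).1 ?_
    rw [Scheme.Hom.comp_appTop]
    exact h
  obtain ⟨l, hl⟩ : ∃ l : esch W ⟶ esch (ebasicOpen t),
      l ≫ emap (ebasicOpenHom t) = emap g ≫ etalePullbackFst i U :=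
    exists_lift_of_range_subset (unitLocus t) _ h'
  let m := (etalePullback_map_isPullback i (ebasicOpenHom t)).lift (emap g) l hl.symm
  have hm : m ≫ emap ((etalePullback i).map (ebasicOpenHom t)) = emap g :=
    (etalePullback_map_isPullback i (ebasicOpenHom t)).lift_fst _ _ _
  refine ⟨ehomMk m ?_, ehom_ext ?_⟩
  · rw [← emap_w ((etalePullback i).map (ebasicOpenHom t)), ← Category.assoc, hm, emap_w]
  · rw [emap_comp, emap_ehomMk, hm]

instance subsingleton_structMonoid (U : Y.Etale) [IsEmpty (esch U)] :
    Subsingleton ((structMonoid Y).obj (op U)) :=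
  inferInstanceAs (Subsingleton Γ(esch U, ⊤))

lemma structMap_naturality (i : Z ⟶ Y) {U V : Y.Etale} (r : V ⟶ U)
    (t : (structMonoid Y).obj (op U)) :
    (structMap i).app (op V) ((structMonoid Y).map r.op t) =
      (structMonoid Z).map ((etalePullback i).map r).op ((structMap i).app (op U) t) :=
  ConcreteCategory.congr_hom ((structMap i).naturality r.op) t

/-- Units on `U ×_Y Z` lift to units on `U`, locally on `U`. -/
lemma exists_lift_unit (i : Z ⟶ Y) [IsClosedImmersion i] (U : Y.Etale)
    (s : ((structMonoid Z).obj (op ((etalePullback i).obj U)))ˣ) :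
    ∃ S ∈ Y.smallEtaleTopology U, ∀ (V : Y.Etale) (r : V ⟶ U), S r →
      ∃ t : ((structMonoid Y).obj (op V))ˣ,
        Units.map ((structMap i).app (op V)).hom t =
          Units.map ((structMonoid Z).map ((etalePullback i).map r).op).hom s := by
  refine exists_cover_of_etalePullback i ?_ ?_ ?_
  · rintro V W r q ⟨t, ht⟩
    refine ⟨Units.map ((structMonoid Y).map q.op).hom t, Units.ext ?_⟩
    refine (structMap_naturality i q t).trans ?_
    refine (congr_arg ((structMonoid Z).map ((etalePullback i).map q).op)
      (congr_arg Units.val ht)).trans ?_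
    rw [Functor.map_comp, op_comp, Functor.map_comp]
    rfl
  · intro x
    -- On an affine neighbourhood, restriction to the closed subscheme is surjective on functions.
    -- The lift `t` of the unit is invertible at the points of `Z`, so it becomes a unit on
    -- `ebasicOpen t`, which still contains the given point.
    obtain ⟨A, a, ha, ⟨y, hy⟩, -⟩ := Scheme.exists_affine_mem_range_and_range_subset
      (X := esch U) (x := etalePullbackFst i U x) (U := ⊤) trivial
    let V := eover a
    have : IsAffine (esch V) := inferInstanceAs (IsAffine (Spec A))
    obtain ⟨t, ht⟩ := (IsClosedImmersion.isAffine_surjective_of_isAffine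
      (etalePullbackFst i V)).2 ((structMonoid Z).map ((etalePullback i).map (eoverHom a)).op s)
    refine ⟨ebasicOpen (U := V) t, ebasicOpenHom (U := V) t ≫ eoverHom a, ?_, ?_⟩
    · refine ⟨(isUnit_map_ebasicOpenHom (U := V) t).unit, Units.ext ?_⟩
      refine (structMap_naturality i (ebasicOpenHom (U := V) t) t).trans ?_
      refine (congr_arg ((structMonoid Z).map
        ((etalePullback i).map (ebasicOpenHom (U := V) t)).op) ht).trans ?_
      rw [Functor.map_comp, op_comp, Functor.map_comp]
      rfl
    · obtain ⟨w, -, hw⟩ := Scheme.Pullback.exists_preimage_pullback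
        (f := etalePullbackFst i U) (g := emap (eoverHom a)) x y hy.symm
      have hy' : y ∈ Set.range (etalePullbackFst i V) := by
        refine ⟨(etalePullback_map_isPullback i (eoverHom a)).isoPullback.inv w, ?_⟩
        refine (Scheme.Hom.comp_apply _ (etalePullbackFst i V) _).symm.trans ?_
        refine Eq.trans ?_ hw
        exact congr_arg (fun f : pullback (etalePullbackFst i U) (emap (eoverHom a)) ⟶ Spec A => f w)
          (etalePullback_map_isPullback i (eoverHom a)).isoPullback_inv_snd
      have hu : IsUnit ((etalePullbackFst i V).appTop t) := by
        rw [ht]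
        exact s.isUnit.map ((structMonoid Z).map ((etalePullback i).map (eoverHom a)).op).hom
      obtain ⟨v, hv⟩ := (range_ebasicOpenHom (U := V) t).ge ((isUnit_appTop_iff _ _).1 hu hy')
      refine ⟨v, ?_⟩
      rw [emap_comp, Scheme.Hom.comp_apply, hv]
      exact hy
  · intro V r hV
    -- Away from `Z` the target is the zero ring, so any unit lifts.
    exact ⟨1, Units.ext ((subsingleton_structMonoid ((etalePullback i).obj V)).elim _ _)⟩

end Units

/-! ### Push-forward preserves injectives and, for closed immersions, is exact -/

section Pushforward

variable {Z Y : Scheme.{u}}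

instance preservesLimitsOfShape_pushforward (f : Z ⟶ Y) (K : Type*) [Category* K]
    [HasLimitsOfShape K AddCommGrpCat.{u}] : PreservesLimitsOfShape K (pushforward f) := by
  have : PreservesLimitsOfShape K (pushforward f ⋙ sheafToPresheaf _ _) :=
    inferInstanceAs (PreservesLimitsOfShape K
      (sheafToPresheaf _ _ ⋙ (Functor.whiskeringLeft _ _ _).obj (etalePullback f).op))
  exact preservesLimitsOfShape_of_reflects_of_preserves (pushforward f) (sheafToPresheaf _ _)

section Injectives

/-- The geometric points of `U ×_Y Z` over a geometric point of `Z` are the geometric points of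
`U` over its image in `Y`. -/
def fiberEtalePullback (f : Z ⟶ Y) {Ω : Type u} [Field Ω] [IsSepClosed Ω]
    (s : Spec (.of Ω) ⟶ Z) : etalePullback f ⋙ (Scheme.pointSmallEtale s).fiber ⟶
      (Scheme.pointSmallEtale (s ≫ f)).fiber where
  app U := TypeCat.ofHom fun t => Over.homMk (t.left ≫ etalePullbackFst f U) (by
    have h := Over.w t
    refine (Category.assoc _ _ _).trans ?_
    refine (congr_arg (t.left ≫ ·) (etalePullback_isPullback f U).w).trans ?_
    refine (Category.assoc _ _ _).symm.trans ?_
    exact congr_arg (· ≫ f) h)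
  naturality U V g := by
    ext t
    refine Over.OverMorphism.ext ?_
    refine (Category.assoc t.left (emap ((etalePullback f).map g)) _).trans ?_
    refine (congr_arg (t.left ≫ ·) (etalePullback_map_fst f g)).trans ?_
    exact (Category.assoc _ _ _).symm

lemma fiberEtalePullback_bijective (f : Z ⟶ Y) {Ω : Type u} [Field Ω] [IsSepClosed Ω]
    (s : Spec (.of Ω) ⟶ Z) (U : Y.Etale) :
    Function.Bijective ((fiberEtalePullback f s).app U) := by
  constructor
  · intro t₁ t₂ h
    refine Over.OverMorphism.ext ((etalePullback_isPullback f U).hom_ext ?_ ?_)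
    · exact congr_arg (fun t : (Scheme.pointSmallEtale (s ≫ f)).fiber.obj U => t.left) h
    · exact (Over.w t₁).trans (Over.w t₂).symm
  · intro t
    have ht : t.left ≫ estr U = s ≫ f := Over.w t
    refine ⟨Over.homMk ((etalePullback_isPullback f U).lift t.left s ht)
      ((etalePullback_isPullback f U).lift_snd _ _ _), Over.OverMorphism.ext ?_⟩
    exact (etalePullback_isPullback f U).lift_fst _ _ _

/-- The push-forward of a skyscraper sheaf is a skyscraper sheaf. -/
def pushforwardSkyscraperIso (f : Z ⟶ Y) {Ω : Type u} [Field Ω] [IsSepClosed Ω]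
    (s : Spec (.of Ω) ⟶ Z) (M : AddCommGrpCat.{u}) :
    (pushforward f).obj ((Scheme.pointSmallEtale s).skyscraperSheafFunctor.obj M) ≅
      (Scheme.pointSmallEtale (s ≫ f)).skyscraperSheafFunctor.obj M :=
  have (U : Y.Etale) : IsIso ((fiberEtalePullback f s).app U) :=
    (isIso_iff_bijective _).2 (fiberEtalePullback_bijective f s U)
  have : IsIso (fiberEtalePullback f s) := NatIso.isIso_of_isIso_app _
  (fullyFaithfulSheafToPresheaf _ _).preimageIso
    (((flipFunctor _ _ _).mapIso (Functor.isoWhiskerRight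
      (NatIso.op (asIso (fiberEtalePullback f s)).symm) piFunctor.flip)).app M)

/-- The push-forward is again a skyscraper sheaf, and the skyscraper functor is right adjoint to an
exact stalk functor. -/
lemma injective_pushforward_skyscraper (f : Z ⟶ Y) {Ω : Type u} [Field Ω] [IsSepClosed Ω]
    (s : Spec (.of Ω) ⟶ Z) (M : AddCommGrpCat.{u}) [Injective M] :
    Injective ((pushforward f).obj
      ((Scheme.pointSmallEtale s).skyscraperSheafFunctor.obj M)) :=
  have : Injective ((Scheme.pointSmallEtale (s ≫ f)).skyscraperSheafFunctor.obj M) :=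
    Injective.injective_of_adjoint (Scheme.pointSmallEtale (s ≫ f)).skyscraperSheafAdjunction M
  Injective.of_iso (pushforwardSkyscraperIso f s M).symm this

/-- A geometric point above a point. -/
def geometricPoint (Z : Scheme.{u}) (z : Z) :
    Spec (.of (SeparableClosure (Z.residueField z))) ⟶ Z :=
  (Scheme.SpecToEquivOfField (SeparableClosure (Z.residueField z)) _).2
    ⟨z, CommRingCat.ofHom (algebraMap (Z.residueField z) _)⟩

/-- The stalk at a geometric point. -/
abbrev geometricStalk (Z : Scheme.{u}) (z : Z) :
    Sheaf Z.smallEtaleTopology AddCommGrpCat.{u} ⥤ AddCommGrpCat.{u} :=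
  (Scheme.pointSmallEtale (geometricPoint Z z)).sheafFiber

/-- By adjunction `x` factors through `L.map m`. With `L` a stalk functor, this shows that
`toGodement` is injective on stalks. -/
lemma mono_map_of_comp_eq_homEquiv {C D : Type*} [Category* C] [Category* D] {L : C ⥤ D}
    {R : D ⥤ C} (adj : L ⊣ R) {F P : C} {M : D} (m : F ⟶ P) (p : P ⟶ R.obj M) (x : L.obj F ⟶ M)
    [Mono x] (e : m ≫ p = adj.homEquiv _ _ x) : Mono (L.map m) := by
  have e' : L.map m ≫ L.map p ≫ adj.counit.app M = x := by
    rw [← Functor.map_comp_assoc, e]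
    exact (adj.homEquiv_counit _ _ _).symm.trans ((adj.homEquiv F M).symm_apply_apply x)
  exact mono_of_mono_fac e'

lemma mono_of_mono_geometricStalk {F G : Sheaf Z.smallEtaleTopology AddCommGrpCat.{u}} (φ : F ⟶ G)
    (h : ∀ z, Mono ((geometricStalk Z z).map φ)) : Mono φ := by
  have := (Scheme.isConservativeFamilyOfPoints_pointSmallEtale' Z).jointlyReflectMonomorphisms
    AddCommGrpCat.{u}
  refine (this.mono_iff φ).2 ?_
  rintro ⟨_, ⟨z⟩⟩
  exact h z

/-- The product of skyscraper sheaves in which a sheaf embeds. -/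
def godementSheaf (F : Sheaf Z.smallEtaleTopology AddCommGrpCat.{u}) (z : Z) :
    Sheaf Z.smallEtaleTopology AddCommGrpCat.{u} :=
  (Scheme.pointSmallEtale (geometricPoint Z z)).skyscraperSheafFunctor.obj
    (Injective.under ((geometricStalk Z z).obj F))

/-- The embedding of a sheaf in a product of injective skyscraper sheaves. -/
def toGodement (F : Sheaf Z.smallEtaleTopology AddCommGrpCat.{u}) : F ⟶ ∏ᶜ godementSheaf F :=
  Pi.lift fun z =>
    (Scheme.pointSmallEtale (geometricPoint Z z)).skyscraperSheafAdjunction.homEquiv _ _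
      (Injective.ι ((geometricStalk Z z).obj F))

instance mono_toGodement (F : Sheaf Z.smallEtaleTopology AddCommGrpCat.{u}) :
    Mono (toGodement F) := by
  refine mono_of_mono_geometricStalk _ fun z => ?_
  exact mono_map_of_comp_eq_homEquiv
    (Scheme.pointSmallEtale (geometricPoint Z z)).skyscraperSheafAdjunction _
    (Pi.π (godementSheaf F) z) (Injective.ι ((geometricStalk Z z).obj F)) (Pi.lift_π _ _)

instance preservesInjectiveObjects_pushforward (f : Z ⟶ Y) :
    (pushforward f).PreservesInjectiveObjects where
  injective_obj {J} hJ := by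
    have : ∀ z, Injective ((pushforward f).obj (godementSheaf J z)) := fun z =>
      injective_pushforward_skyscraper f _ _
    -- An injective `J` is a retract of its product of injective skyscrapers. Push-forward commutes
    -- with this product and keeps each factor injective, so it makes `f_* J` a retract of an
    -- injective.
    have h : Injective ((pushforward f).obj (∏ᶜ godementSheaf J)) :=
      Injective.of_iso (PreservesProduct.iso (pushforward f) (godementSheaf J)).symm inferInstance
    refine ⟨fun {X W} g i hi => ?_⟩
    obtain ⟨k, hk⟩ := h.factors (g ≫ (pushforward f).map (toGodement J)) i
    refine ⟨k ≫ (pushforward f).map (Injective.factorThru (𝟙 J) (toGodement J)), ?_⟩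
    rw [reassoc_of% hk, ← Functor.map_comp, Injective.comp_factorThru, (pushforward f).map_id,
      Category.comp_id]

end Injectives

section Exact

lemma subsingleton_of_isEmpty (F : Sheaf Z.smallEtaleTopology AddCommGrpCat.{u}) (W : Z.Etale)
    [IsEmpty (esch W)] : Subsingleton (F.obj.obj (op W)) :=
  AddCommGrpCat.subsingleton_of_isZero
    ((Sheaf.isTerminalOfBotCover F W (bot_mem_smallEtaleTopology W)).isZero)

/-- A section lifts over a cover of `U ×_Y Z`, which comes from a cover of `U` except on pieces
missing `Z`, where there is nothing to lift. -/
lemma epi_pushforward_map (i : Z ⟶ Y) [IsClosedImmersion i]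
    {F G : Sheaf Z.smallEtaleTopology AddCommGrpCat.{u}} (φ : F ⟶ G) [Epi φ] :
    Epi ((pushforward i).map φ) := by
  rw [← Sheaf.isLocallySurjective_iff_epi']
  have : Sheaf.IsLocallySurjective φ := (Sheaf.isLocallySurjective_iff_epi' _ φ).2 inferInstance
  refine ⟨fun {U} s => ?_⟩
  obtain ⟨S, hS, h⟩ := exists_cover_of_mem i
    (Presheaf.imageSieve_mem Z.smallEtaleTopology φ.hom (U := op ((etalePullback i).obj U)) s)
  refine Y.smallEtaleTopology.superset_covering (fun V r hr => ?_) hS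
  rcases h V r hr with ⟨t, ht⟩ | h
  · exact ⟨t, ht⟩
  · exact ⟨0, (subsingleton_of_isEmpty G ((etalePullback i).obj V)).elim _ _⟩

instance preservesHomology_pushforward (i : Z ⟶ Y) [IsClosedImmersion i] :
    (pushforward i).PreservesHomology := by
  refine ((pushforward i).exact_tfae.out 0 2).1 fun S hS => ?_
  have := hS.epi_g
  have := hS.mono_f
  have : Mono ((pushforward i).map S.f) := inferInstance
  have hl : PreservesFiniteLimits (pushforward i) := ⟨fun K _ _ => inferInstance⟩
  have h := ((pushforward i).preservesFiniteLimits_tfae.out 0 3).2 hl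
  exact { exact := (h S hS).1, mono_f := this, epi_g := epi_pushforward_map i S.g }

end Exact

end Pushforward

/-! ### Kernels and epimorphisms of associated sheaves -/

section Sheaves

variable {Z Y : Scheme.{u}}

/-- By `h` the kernel of `ψ` dies in the cokernel of `a`, so it factors through the monomorphism
`a`. Since `b` is a monomorphism, the factorization lands in the kernel of `φ`. -/
lemma isIso_kernel_map_of_locally {F G E H : Sheaf Y.smallEtaleTopology AddCommGrpCat.{u}}
    (φ : F ⟶ E) (ψ : G ⟶ H) (a : F ⟶ G) (b : E ⟶ H) (comm : φ ≫ b = a ≫ ψ) [Mono a] [Mono b]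
    (h : ∀ (U : Y.Etale) (g : G.obj.obj (op U)), ψ.hom.app (op U) g = 0 →
      ∃ S ∈ Y.smallEtaleTopology U, ∀ (V : Y.Etale) (r : V ⟶ U), S r →
        ∃ x : F.obj.obj (op V), a.hom.app (op V) x = G.obj.map r.op g) :
    IsIso (kernel.map φ ψ a b comm) := by
  have hz : kernel.ι ψ ≫ cokernel.π a = 0 := by
    apply Sheaf.hom_ext
    ext U s
    have hs : ψ.hom.app U ((kernel.ι ψ).hom.app U s) = 0 :=
      ConcreteCategory.congr_hom
        (congr_arg (fun k : kernel ψ ⟶ H => k.hom.app U) (kernel.condition ψ)) s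
    obtain ⟨S, hS, hS'⟩ := h U.unop _ hs
    refine (cokernel a).isSeparated _ S hS _ _ fun V r hr => ?_
    obtain ⟨x, hx⟩ := hS' V r hr
    have h₁ : (cokernel a).obj.map r.op ((cokernel.π a).hom.app U ((kernel.ι ψ).hom.app U s)) =
        (cokernel.π a).hom.app (op V) (G.obj.map r.op ((kernel.ι ψ).hom.app U s)) :=
      (NatTrans.naturality_apply (cokernel.π a).hom r.op _).symm
    refine h₁.trans ?_
    rw [← hx]
    refine (ConcreteCategory.congr_hom
        (congr_arg (fun k : F ⟶ cokernel a => k.hom.app (op V)) (cokernel.condition a)) x).trans ?_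
    exact (map_zero ((cokernel a).obj.map r.op).hom).symm
  let k := Abelian.monoLift a (kernel.ι ψ) hz
  have hk : k ≫ a = kernel.ι ψ := Abelian.monoLift_comp _ _ _
  have hk' : k ≫ φ = 0 := by
    rw [← cancel_mono b, Category.assoc, comm, ← Category.assoc, hk, kernel.condition, zero_comp]
  refine ⟨kernel.lift φ k hk', ?_, ?_⟩
  · rw [← cancel_mono (kernel.ι φ), ← cancel_mono a]
    simp [hk]
  · rw [← cancel_mono (kernel.ι ψ)]
    simp [hk]

lemma toSheafify_comp_sheafifyToPushforward (f : Z ⟶ Y) {P : Y.Etaleᵒᵖ ⥤ AddCommGrpCat.{u}}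
    {Q : Z.Etaleᵒᵖ ⥤ AddCommGrpCat.{u}} (φ : P ⟶ (etalePullback f).op ⋙ Q) :
    toSheafify Y.smallEtaleTopology P ≫ (sheafifyToPushforward f φ).hom =
      φ ≫ Functor.whiskerLeft (etalePullback f).op (toSheafify Z.smallEtaleTopology Q) :=
  ((sheafificationAdjunction _ _).homEquiv_unit _ _ _).symm.trans (Equiv.apply_symm_apply _ _)

lemma toSheafify_comp_map {P Q : Y.Etaleᵒᵖ ⥤ AddCommGrpCat.{u}} (φ : P ⟶ Q) :
    toSheafify Y.smallEtaleTopology P ≫ ((etaleSheafify Y).map φ).hom =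
      φ ≫ toSheafify Y.smallEtaleTopology Q :=
  (toSheafify_naturality _ φ).symm

lemma etaleSheafify_hom_ext {P : Y.Etaleᵒᵖ ⥤ AddCommGrpCat.{u}}
    {F : Sheaf Y.smallEtaleTopology AddCommGrpCat.{u}} {φ ψ : (etaleSheafify Y).obj P ⟶ F}
    (h : toSheafify Y.smallEtaleTopology P ≫ φ.hom = toSheafify Y.smallEtaleTopology P ≫ ψ.hom) :
    φ = ψ :=
  ((sheafificationAdjunction _ _).homEquiv _ _).injective
    (((sheafificationAdjunction _ _).homEquiv_unit _ _ _).trans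
      (h.trans ((sheafificationAdjunction _ _).homEquiv_unit _ _ _).symm))

lemma isLocallySurjective_whiskerLeft_etalePullback (i : Z ⟶ Y) [IsClosedImmersion i]
    {P : Z.Etaleᵒᵖ ⥤ AddCommGrpCat.{u}} (F : Sheaf Z.smallEtaleTopology AddCommGrpCat.{u})
    (φ : P ⟶ F.obj) [Presheaf.IsLocallySurjective Z.smallEtaleTopology φ] :
    Presheaf.IsLocallySurjective Y.smallEtaleTopology
      (Functor.whiskerLeft (etalePullback i).op φ) := by
  refine ⟨fun {U} s => ?_⟩
  obtain ⟨S, hS, h⟩ := exists_cover_of_mem i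
    (Presheaf.imageSieve_mem Z.smallEtaleTopology φ (U := op ((etalePullback i).obj U)) s)
  refine Y.smallEtaleTopology.superset_covering (fun V r hr => ?_) hS
  rcases h V r hr with ⟨t, ht⟩ | h
  · exact ⟨t, ht⟩
  · exact ⟨0, (subsingleton_of_isEmpty F ((etalePullback i).obj V)).elim _ _⟩

lemma isLocallySurjective_of_comp {P Q R : Y.Etaleᵒᵖ ⥤ AddCommGrpCat.{u}} (φ : P ⟶ Q) (ψ : Q ⟶ R)
    (h : Presheaf.IsLocallySurjective Y.smallEtaleTopology (φ ≫ ψ)) :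
    Presheaf.IsLocallySurjective Y.smallEtaleTopology ψ :=
  Presheaf.isLocallySurjective_of_isLocallySurjective _ φ ψ

lemma epi_sheafifyToPushforward (i : Z ⟶ Y) [IsClosedImmersion i]
    {P : Y.Etaleᵒᵖ ⥤ AddCommGrpCat.{u}} {Q : Z.Etaleᵒᵖ ⥤ AddCommGrpCat.{u}}
    (φ : P ⟶ (etalePullback i).op ⋙ Q) [Presheaf.IsLocallySurjective Y.smallEtaleTopology φ] :
    Epi (sheafifyToPushforward i φ) := by
  rw [← Sheaf.isLocallySurjective_iff_epi']
  have := isLocallySurjective_whiskerLeft_etalePullback i ((etaleSheafify Z).obj Q)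
    (toSheafify Z.smallEtaleTopology Q)
  have := Presheaf.isLocallySurjective_comp Y.smallEtaleTopology φ
    (Functor.whiskerLeft (etalePullback i).op (toSheafify Z.smallEtaleTopology Q))
  rw [← toSheafify_comp_sheafifyToPushforward] at this
  exact isLocallySurjective_of_comp _ _ this

lemma mono_etaleSheafify_map {P Q : Y.Etaleᵒᵖ ⥤ AddCommGrpCat.{u}} (φ : P ⟶ Q)
    (h : ∀ U, Function.Injective (φ.app U)) : Mono ((etaleSheafify Y).map φ) := by
  have (U : Y.Etaleᵒᵖ) : Mono (φ.app U) := ConcreteCategory.mono_of_injective _ (h U)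
  have : Mono φ := NatTrans.mono_of_mono_app φ
  infer_instance

/-- The map `𝒪_Y^× ⟶ i_* 𝒪_Z^×` is surjective. -/
instance epi_unitsSheafMap (i : Z ⟶ Y) [IsClosedImmersion i] : Epi (unitsSheafMap i) := by
  have : Presheaf.IsLocallySurjective Y.smallEtaleTopology
      (Functor.whiskerRight (structMap i) (CommMonCat.units ⋙ CommGrpCat.toAddCommGrp)) := by
    refine ⟨fun {U} s => ?_⟩
    obtain ⟨S, hS, h⟩ := exists_lift_unit i U (Additive.toMul s)
    refine Y.smallEtaleTopology.superset_covering (fun V r hr => ?_) hS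
    obtain ⟨t, ht⟩ := h V r hr
    exact ⟨Additive.ofMul t, congr_arg Additive.ofMul ht⟩
  exact epi_sheafifyToPushforward i _

end Sheaves

/-! ### Integrality of fs log structures -/

namespace LogStructure

variable {Y : Scheme.{u}} (L : LogStructure Y)

lemma map_map {U V W : Y.Etale} (r : V ⟶ U) (s : W ⟶ V) (m : L.sheaf.obj.obj (op U)) :
    L.sheaf.obj.map s.op (L.sheaf.obj.map r.op m) = L.sheaf.obj.map (s ≫ r).op m :=
  (ConcreteCategory.congr_hom (L.sheaf.obj.map_comp r.op s.op) m).symm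

lemma map_mul' {U V : Y.Etale} (r : V ⟶ U) (m n : L.sheaf.obj.obj (op U)) :
    L.sheaf.obj.map r.op (m * n) = L.sheaf.obj.map r.op m * L.sheaf.obj.map r.op n :=
  map_mul (L.sheaf.obj.map r.op).hom m n

lemma α_map {U V : Y.Etale} (r : V ⟶ U) (m : L.sheaf.obj.obj (op U)) :
    L.α.app (op V) (L.sheaf.obj.map r.op m) = (structMonoid Y).map r.op (L.α.app (op U) m) :=
  ConcreteCategory.congr_hom (L.α.naturality r.op) m

lemma exists_eq_unit {U : Y.Etaleᵒᵖ} {m : L.sheaf.obj.obj U} (h : IsUnit (L.α.app U m)) :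
    ∃ v, m = L.unit U v :=
  ⟨h.unit, L.eq_unit rfl⟩

lemma ext_of_cover {U : Y.Etale} {m n : L.sheaf.obj.obj (op U)} {S : Sieve U}
    (hS : S ∈ Y.smallEtaleTopology U)
    (h : ∀ (V : Y.Etale) (r : V ⟶ U), S r → L.sheaf.obj.map r.op m = L.sheaf.obj.map r.op n) :
    m = n :=
  L.sheaf.isSeparated U S hS m n h

lemma mul_unit_cancel {U : Y.Etaleᵒᵖ} {m n : L.sheaf.obj.obj U}
    {v : ((structMonoid Y).obj U)ˣ} (h : m * L.unit U v = n * L.unit U v) : m = n := by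
  have := congr_arg (· * L.unit U v⁻¹) h
  simpa only [mul_assoc, ← map_mul, mul_inv_cancel, map_one, mul_one] using this

variable {L} in
/-- A log structure with a chart by an integral monoid is integral. -/
lemma IsChart.eq_of_mul_eq_mul {U : Y.Etale} {P : Type*} [CommMonoid P]
    {β : P →* L.sheaf.obj.obj (op U)} (hβ : L.IsChart β)
    (hP : ∀ a b c : P, a * b = a * c → b = c) {m a b : L.sheaf.obj.obj (op U)}
    (h : m * a = m * b) : a = b := by
  obtain ⟨S₁, hS₁, h₁⟩ := hβ.locally_surjective U (𝟙 U) m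
  obtain ⟨S₂, hS₂, h₂⟩ := hβ.locally_surjective U (𝟙 U) a
  obtain ⟨S₃, hS₃, h₃⟩ := hβ.locally_surjective U (𝟙 U) b
  refine L.ext_of_cover (Y.smallEtaleTopology.intersection_covering hS₁
    (Y.smallEtaleTopology.intersection_covering hS₂ hS₃)) fun V k hk => ?_
  obtain ⟨p₁, v₁, e₁⟩ := h₁ V k hk.1
  obtain ⟨p₂, v₂, e₂⟩ := h₂ V k hk.2.1
  obtain ⟨p₃, v₃, e₃⟩ := h₃ V k hk.2.2
  rw [Category.comp_id] at e₁ e₂ e₃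
  have e : L.unit (op V) (v₁ * v₂) * L.sheaf.obj.map k.op (β (p₁ * p₂)) =
      L.unit (op V) (v₁ * v₃) * L.sheaf.obj.map k.op (β (p₁ * p₃)) := by
    have := congr_arg (L.sheaf.obj.map k.op) h
    rw [map_mul', map_mul', e₁, e₂, e₃] at this
    rw [map_mul β, map_mul β, map_mul', map_mul', map_mul (L.unit _), map_mul (L.unit _),
      mul_mul_mul_comm, this, mul_mul_mul_comm]
  -- Writing all sections as units times chart elements, the hypothesis becomes an equality of
  -- images of `p₁ p₂` and `p₁ p₃`. Local injectivity lifts it to a relation in `P`, where `p₁`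
  -- cancels.
  obtain ⟨S, hS, H⟩ := hβ.locally_injective V k _ _ _ _ e
  refine L.ext_of_cover hS fun W j hj => ?_
  obtain ⟨q, q', w, w', hw, hw', hq, hv⟩ := H W j hj
  dsimp only at hq hv
  have hq' : p₂ * q = p₃ * q' := hP p₁ _ _ (by rw [← mul_assoc, ← mul_assoc, hq])
  rw [map_mul, map_mul, mul_assoc, mul_assoc] at hv
  have hv' := mul_left_cancel hv
  have hβw : L.sheaf.obj.map (j ≫ k).op (β q) = L.unit (op W) w := L.eq_unit hw
  have hβw' : L.sheaf.obj.map (j ≫ k).op (β q') = L.unit (op W) w' := L.eq_unit hw'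
  -- The elements `q` and `q'` of the congruence map to the units `w` and `w'`, so multiplying by `w
  -- w'` loses nothing and brings both relations into play.
  apply L.mul_unit_cancel (v := w * w')
  rw [e₂, e₃, map_mul', map_mul', map_unit, map_unit, map_map, map_map, map_mul, ← hβw, ← hβw']
  have k₁ : L.sheaf.obj.map (j ≫ k).op (β p₂) * L.sheaf.obj.map (j ≫ k).op (β q) =
      L.sheaf.obj.map (j ≫ k).op (β p₃) * L.sheaf.obj.map (j ≫ k).op (β q') := by
    rw [← map_mul', ← map_mul', ← map_mul, ← map_mul, hq']
  have k₂ := congr_arg (L.unit (op W)) hv'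
  rw [map_mul, map_mul, ← hβw, ← hβw'] at k₂
  rw [mul_comm (L.sheaf.obj.map (j ≫ k).op (β q)), mul_mul_mul_comm, k₁, k₂, mul_mul_mul_comm,
    mul_comm (L.sheaf.obj.map (j ≫ k).op (β q'))]

variable {L} in
/-- Fine log structures are integral. -/
lemma IsFS.eq_of_mul_eq_mul (hL : L.IsFS) {U : Y.Etale} {m a b : L.sheaf.obj.obj (op U)}
    (h : m * a = m * b) : a = b := by
  obtain ⟨S, hS, H⟩ := hL
  let t : U ⟶ etaleTop Y := ehomMk (estr U) (Category.comp_id _)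
  refine L.ext_of_cover (Y.smallEtaleTopology.pullback_stable t hS) fun V r hr => ?_
  obtain ⟨P, _, β, hP, hβ⟩ := H V (r ≫ t) hr
  refine hβ.eq_of_mul_eq_mul hP.integral (m := L.sheaf.obj.map r.op m) ?_
  rw [← map_mul', ← map_mul', h]

/-- The map `ℳ ⟶ ℳ^gp`, written additively on the right. -/
def toGp {U : Y.Etaleᵒᵖ} (m : L.sheaf.obj.obj U) : L.gpPresheaf.obj U :=
  Additive.ofMul (Algebra.GrothendieckGroup.of m)

lemma exists_eq_sub {U : Y.Etaleᵒᵖ} (x : L.gpPresheaf.obj U) : ∃ m n, x = L.toGp m - L.toGp n := by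
  obtain ⟨⟨m, n⟩, h⟩ := (Localization.monoidOf (⊤ : Submonoid (L.sheaf.obj.obj U))).surj
    (Additive.toMul x)
  exact ⟨m, n, eq_sub_of_add_eq (congr_arg Additive.ofMul h)⟩

lemma toGp_mul {U : Y.Etaleᵒᵖ} (m n : L.sheaf.obj.obj U) :
    L.toGp (m * n) = L.toGp m + L.toGp n :=
  congr_arg Additive.ofMul (map_mul Algebra.GrothendieckGroup.of m n)

lemma gpPresheaf_map_toGp {U V : Y.Etaleᵒᵖ} (r : U ⟶ V) (m : L.sheaf.obj.obj U) :
    L.gpPresheaf.map r (L.toGp m) = L.toGp (L.sheaf.obj.map r m) :=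
  congr_arg Additive.ofMul (DFunLike.congr_fun (gpMap_comp_of (L.sheaf.obj.map r).hom) m)

variable {L} in
lemma IsFS.toGp_injective (hL : L.IsFS) (U : Y.Etaleᵒᵖ) :
    Function.Injective (L.toGp (U := U)) := by
  have : IsCancelMul (L.sheaf.obj.obj U) :=
    { mul_left_cancel := fun a b c h => hL.eq_of_mul_eq_mul h
      mul_right_cancel := fun a b c h =>
        hL.eq_of_mul_eq_mul (m := a) (by rw [mul_comm a, mul_comm a]; exact h) }
  exact Algebra.GrothendieckGroup.of_injective

lemma unit_injective (U : Y.Etaleᵒᵖ) : Function.Injective (L.unit U) := fun v w h => Units.ext (by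
  rw [← L.α_unit U v, ← L.α_unit U w, h])

variable {L} in
lemma IsFS.mono_unitsToGp (hL : L.IsFS) : Mono L.unitsToGp :=
  mono_etaleSheafify_map _ fun U _ _ h =>
    L.unit_injective U (hL.toGp_injective U h)

end LogStructure

/-! ### Checking covers near `Z` and away from `Z` -/

section Covers

variable {Y Z : Scheme.{u}}

lemma etalePullback_etaleTop_hom_ext (i : Z ⟶ Y) {X : Z.Etale}
    (f g : X ⟶ (etalePullback i).obj (etaleTop Y)) : f = g := by
  have h (f : X ⟶ (etalePullback i).obj (etaleTop Y)) :
      emap f ≫ etalePullbackFst i (etaleTop Y) = estr X ≫ i :=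
    (congr_arg (emap f ≫ ·) ((Category.comp_id _).symm.trans
      (etalePullback_isPullback i (etaleTop Y)).w)).trans
      ((Category.assoc _ _ _).symm.trans (congr_arg (· ≫ i) (emap_w f)))
  apply ehom_ext
  apply (etalePullback_isPullback i (etaleTop Y)).hom_ext
  · rw [h, h]
  · rw [emap_w, emap_w]

lemma etalePullbackFst_mem_range (i : Z ⟶ Y) {U V : Y.Etale} {X : Z.Etale}
    (l : X ⟶ (etalePullback i).obj V) (r : V ⟶ U) (x : esch X) :
    etalePullbackFst i U (emap (l ≫ (etalePullback i).map r) x) ∈ Set.range (emap r) := by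
  refine ⟨etalePullbackFst i V (emap l x), ?_⟩
  rw [← Scheme.Hom.comp_apply, ← Scheme.Hom.comp_apply, ← Scheme.Hom.comp_apply, emap_comp,
    Category.assoc, ← etalePullback_map_fst]

/-- Being a covering sieve is local, so it may be checked near each point of `Z` and on the objects
missing `Z`. -/
lemma mem_of_etalePullback (i : Z ⟶ Y) [IsClosedImmersion i] {U : Y.Etale} (R : Sieve U)
    (h₁ : ∀ x : esch ((etalePullback i).obj U), ∃ (V : Y.Etale) (r : V ⟶ U),
      R.pullback r ∈ Y.smallEtaleTopology V ∧ etalePullbackFst i U x ∈ Set.range (emap r))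
    (h₂ : ∀ (V : Y.Etale) (r : V ⟶ U), IsEmpty (esch ((etalePullback i).obj V)) → R r) :
    R ∈ Y.smallEtaleTopology U := by
  obtain ⟨S, hS, h⟩ := exists_cover_of_etalePullback i
    (P := fun V r => R.pullback r ∈ Y.smallEtaleTopology V) (fun V W r s h => by
      rw [Sieve.pullback_comp]; exact Y.smallEtaleTopology.pullback_stable s h) h₁
    (fun V r h => by
      rw [Sieve.pullback_eq_top_of_mem R (h₂ V r h)]; exact Y.smallEtaleTopology.top_mem V)
  exact Y.smallEtaleTopology.transitive hS R fun V r hr => h V r hr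

end Covers

/-! ### Consequences of strictness for sections of the log structures -/

namespace LogScheme.Hom

variable {Z Y : LogScheme.{u}} (i : LogScheme.Hom Z Y)

/-- The homomorphism `ℳ_Y(U) → ℳ_Z(U ×_Y Z)`. -/
def onSections (U : Y.scheme.Etale) : Y.log.sheaf.obj.obj (op U) →*
    Z.log.sheaf.obj.obj (op ((etalePullback i.base).obj U)) :=
  (i.flat.app (op U)).hom

lemma onSections_map {U V : Y.scheme.Etale} (r : V ⟶ U) (m : Y.log.sheaf.obj.obj (op U)) :
    i.onSections V (Y.log.sheaf.obj.map r.op m) =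
      Z.log.sheaf.obj.map ((etalePullback i.base).map r).op (i.onSections U m) :=
  ConcreteCategory.congr_hom (i.flat.naturality r.op) m

lemma α_onSections (U : Y.scheme.Etale) (m : Y.log.sheaf.obj.obj (op U)) :
    Z.log.α.app (op ((etalePullback i.base).obj U)) (i.onSections U m) =
      (structMap i.base).app (op U) (Y.log.α.app (op U) m) :=
  ConcreteCategory.congr_hom (congr_arg (fun t => t.app (op U)) i.comm) m

lemma onSections_unit (U : Y.scheme.Etale) (v : ((structMonoid Y.scheme).obj (op U))ˣ) :
    i.onSections U (Y.log.unit (op U) v) =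
      Z.log.unit (op ((etalePullback i.base).obj U))
        (Units.map ((structMap i.base).app (op U)).hom v) := by
  apply Z.log.eq_unit
  rw [α_onSections, LogStructure.α_unit]
  rfl

lemma pullSectionα_apply {U : Y.scheme.Etale} {W : Z.scheme.Etale}
    (g : W ⟶ (etalePullback i.base).obj U) (m : Y.log.sheaf.obj.obj (op U)) :
    i.pullSectionα g m =
      (structMonoid Z.scheme).map g.op ((structMap i.base).app (op U) (Y.log.α.app (op U) m)) := by
  refine (Z.log.α_map g (i.onSections U m)).trans ?_
  rw [α_onSections]

variable {i}

/-- Strictness gives `m` locally as a unit of `𝒪_Z` times the image of a section of `ℳ_Y`; the unit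
itself lifts to `𝒪_Y^×` by `exists_lift_unit`, so no unit factor is left over. -/
lemma IsStrict.exists_onSections_eq (hi : i.IsStrict) [IsClosedImmersion i.base]
    (U : Y.scheme.Etale)
    (m : Z.log.sheaf.obj.obj (op ((etalePullback i.base).obj U))) :
    ∃ S ∈ Y.scheme.smallEtaleTopology U, ∀ (V : Y.scheme.Etale) (r : V ⟶ U), S r →
      ∃ n, i.onSections V n = Z.log.sheaf.obj.map ((etalePullback i.base).map r).op m := by
  refine ⟨⟨fun V r => ∃ n, i.onSections V n =
    Z.log.sheaf.obj.map ((etalePullback i.base).map r).op m, ?_⟩, ?_, fun V r h => h⟩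
  · rintro V W r ⟨n, hn⟩ s
    refine ⟨Y.log.sheaf.obj.map s.op n, ?_⟩
    rw [onSections_map, hn, LogStructure.map_map, Functor.map_comp]
  apply mem_of_etalePullback i.base
  · intro x
    obtain ⟨S, hS, H⟩ := hi.locally_surjective _ m
    obtain ⟨X, j, hj, w, rfl⟩ := (mem_smallEtaleTopology_iff _).1 hS x
    obtain ⟨U', g, n, v, e⟩ := H X j hj
    -- The section `n` lives on an étale `U'` a priori unrelated to `U`. Passing to a common étale
    -- scheme over `U` and `U'`, and then extending `X` off `Z`, gives `V` on which both can be
    -- compared.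
    obtain ⟨P, p₁, p₂, l, -, h₁, h₂⟩ := etalePullback_exists_lift i.base
      (ehomMk (V := etaleTop Y.scheme) (estr U) (Category.comp_id _))
      (ehomMk (V := etaleTop Y.scheme) (estr U') (Category.comp_id _)) j g
      (etalePullback_etaleTop_hom_ext _ _ _)
    obtain ⟨V, r, h, hr, y, rfl⟩ := exists_etalePullback_hom i.base l w
    have k₁ : h ≫ j = (etalePullback i.base).map (r ≫ p₁) := by
      rw [← h₁, ← Category.assoc, hr, Functor.map_comp]
    have k₂ : h ≫ g = (etalePullback i.base).map (r ≫ p₂) := by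
      rw [← h₂, ← Category.assoc, hr, Functor.map_comp]
    refine ⟨V, r ≫ p₁, ?_, ?_⟩
    · obtain ⟨T, hT, hT'⟩ := exists_lift_unit i.base V
        (Units.map ((structMonoid Z.scheme).map h.op).hom v)
      refine Y.scheme.smallEtaleTopology.superset_covering (fun W s hs => ?_) hT
      obtain ⟨t, ht⟩ := hT' W s hs
      refine ⟨Y.log.unit _ t * Y.log.sheaf.obj.map s.op (Y.log.sheaf.obj.map (r ≫ p₂).op n), ?_⟩
      have e' := congr_arg (Z.log.sheaf.obj.map ((etalePullback i.base).map s ≫ h).op) e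
      rw [LogStructure.map_map, Category.assoc, k₁, ← Functor.map_comp] at e'
      rw [e', map_mul, onSections_unit, ht, onSections_map, onSections_map, LogStructure.map_mul',
        ← LogStructure.map_map, ← LogStructure.map_map, LogStructure.map_unit,
        LogStructure.map_unit, ← k₂, ← LogStructure.map_map]
      rfl
    · have : emap j (emap h y) = emap (𝟙 _ ≫ (etalePullback i.base).map (r ≫ p₁)) y := by
        rw [Category.id_comp, ← k₁, emap_comp, Scheme.Hom.comp_apply]
      rw [this]
      exact etalePullbackFst_mem_range _ _ _ _
  · intro V r hV
    -- The empty cover forces all sections over an empty scheme to coincide.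
    refine ⟨1, Z.log.ext_of_cover (bot_mem_smallEtaleTopology _) fun _ _ h => h.elim⟩

/-- The core of the kernel computation. Near `Z`, strictness gives `m₁ h = m₂ h'` with `h` and `h'`
invertible on `Z`, hence on a neighbourhood; away from `Z`, both sections are units. -/
lemma IsStrict.exists_unit_mul_eq (hi : i.IsStrict) [IsClosedImmersion i.base]
    (htriv : Y.log.IsTrivialOn (Set.range i.base)ᶜ) {U : Y.scheme.Etale}
    {m₁ m₂ : Y.log.sheaf.obj.obj (op U)} (hm : i.onSections U m₁ = i.onSections U m₂) :
    ∃ S ∈ Y.scheme.smallEtaleTopology U, ∀ (V : Y.scheme.Etale) (r : V ⟶ U), S r →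
      ∃ t, Y.log.sheaf.obj.map r.op m₁ = Y.log.unit (op V) t * Y.log.sheaf.obj.map r.op m₂ := by
  refine ⟨⟨fun V r => ∃ t, Y.log.sheaf.obj.map r.op m₁ =
    Y.log.unit (op V) t * Y.log.sheaf.obj.map r.op m₂, ?_⟩, ?_, fun V r h => h⟩
  · rintro V W r ⟨t, ht⟩ s
    refine ⟨Units.map ((structMonoid Y.scheme).map s.op).hom t, ?_⟩
    rw [← LogStructure.map_map, ← LogStructure.map_map, ht, LogStructure.map_mul',
      LogStructure.map_unit]
  apply mem_of_etalePullback i.base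
  · intro x
    obtain ⟨S, hS, H⟩ := hi.locally_injective U _ (𝟙 _) m₁ m₂ 1 1 (by
      change _ * Z.log.sheaf.obj.map _ (i.onSections U m₁) =
        _ * Z.log.sheaf.obj.map _ (i.onSections U m₂)
      rw [hm])
    obtain ⟨X, j, hj, y, rfl⟩ := (mem_smallEtaleTopology_iff _).1 hS x
    obtain ⟨U₁, r, g, hg, h, h', w, w', e, e', k, -⟩ := H X j hj
    dsimp only at k
    rw [Category.comp_id] at hg
    -- Using the product `h * h'` makes both factors invertible on one open subscheme, through which
    -- `g` still factors.
    obtain ⟨g', hg'⟩ := exists_lift_ebasicOpen i.base (Y.log.α.app (op U₁) (h * h')) g (by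
      rw [← pullSectionα_apply, map_mul, e, e']
      exact w.isUnit.mul w'.isUnit)
    have hu := isUnit_map_ebasicOpenHom (Y.log.α.app (op U₁) (h * h'))
    revert g' hu
    generalize ebasicOpenHom (Y.log.α.app (op U₁) (h * h')) = q
    generalize ebasicOpen (Y.log.α.app (op U₁) (h * h')) = V at q
    intro g' hg' hu
    refine ⟨V, q ≫ r, ?_, ?_⟩
    · rw [Sieve.pullback_eq_top_of_mem]
      · exact Y.scheme.smallEtaleTopology.top_mem V
      rw [← LogStructure.α_map, LogStructure.map_mul', map_mul, IsUnit.mul_iff] at hu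
      obtain ⟨a, ha⟩ := Y.log.exists_eq_unit hu.1
      obtain ⟨b, hb⟩ := Y.log.exists_eq_unit hu.2
      refine ⟨b * a⁻¹, Y.log.mul_unit_cancel (v := a) ?_⟩
      have := congr_arg (Y.log.sheaf.obj.map q.op) k
      rw [LogStructure.map_mul', LogStructure.map_mul', LogStructure.map_map,
        LogStructure.map_map, ha, hb] at this
      rw [this, mul_right_comm, ← map_mul, inv_mul_cancel_right, mul_comm]
    · rw [← hg, ← hg', Category.assoc, ← Functor.map_comp]
      exact etalePullbackFst_mem_range _ _ _ _
  · intro V r hV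
    have hV' := htriv V ((isEmpty_esch_etalePullback_iff _ _).1 hV)
    obtain ⟨a, ha⟩ := Y.log.exists_eq_unit (hV' (Y.log.sheaf.obj.map r.op m₁))
    obtain ⟨b, hb⟩ := Y.log.exists_eq_unit (hV' (Y.log.sheaf.obj.map r.op m₂))
    refine ⟨a * b⁻¹, ?_⟩
    rw [ha, hb, ← map_mul, inv_mul_cancel_right]

end LogScheme.Hom

/-! ### Sections of associated sheaves -/

section Sheaves

variable {Y : Scheme.{u}}

/-- The map from a presheaf to its associated sheaf, on sections. -/
def sheafifyApp (P : Y.Etaleᵒᵖ ⥤ AddCommGrpCat.{u}) (U : Y.Etaleᵒᵖ) :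
    P.obj U →+ ((etaleSheafify Y).obj P).obj.obj U :=
  ((toSheafify Y.smallEtaleTopology P).app U).hom

lemma sheafifyApp_map (P : Y.Etaleᵒᵖ ⥤ AddCommGrpCat.{u}) {U V : Y.Etaleᵒᵖ} (r : U ⟶ V)
    (x : P.obj U) : sheafifyApp P V (P.map r x) =
      ((etaleSheafify Y).obj P).obj.map r (sheafifyApp P U x) :=
  ConcreteCategory.congr_hom ((toSheafify Y.smallEtaleTopology P).naturality r) x

lemma exists_sheafifyApp_eq (P : Y.Etaleᵒᵖ ⥤ AddCommGrpCat.{u}) (U : Y.Etale)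
    (s : ((etaleSheafify Y).obj P).obj.obj (op U)) :
    ∃ S ∈ Y.smallEtaleTopology U, ∀ (V : Y.Etale) (r : V ⟶ U), S r →
      ∃ x, sheafifyApp P (op V) x = ((etaleSheafify Y).obj P).obj.map r.op s :=
  ⟨_, Presheaf.imageSieve_mem Y.smallEtaleTopology (toSheafify Y.smallEtaleTopology P)
    (U := op U) s, fun _ _ h => h⟩

lemma exists_cover_of_sheafifyApp_eq (P : Y.Etaleᵒᵖ ⥤ AddCommGrpCat.{u}) (U : Y.Etale)
    {x y : P.obj (op U)} (h : sheafifyApp P (op U) x = sheafifyApp P (op U) y) :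
    ∃ S ∈ Y.smallEtaleTopology U, ∀ (V : Y.Etale) (r : V ⟶ U), S r →
      P.map r.op x = P.map r.op y :=
  ⟨_, Presheaf.equalizerSieve_mem Y.smallEtaleTopology (toSheafify Y.smallEtaleTopology P)
    (X := op U) x y h, fun _ _ h => h⟩

lemma etaleSheafify_map_sheafifyApp {P Q : Y.Etaleᵒᵖ ⥤ AddCommGrpCat.{u}} (φ : P ⟶ Q)
    (U : Y.Etaleᵒᵖ) (x : P.obj U) :
    ((etaleSheafify Y).map φ).hom.app U (sheafifyApp P U x) = sheafifyApp Q U (φ.app U x) :=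
  ConcreteCategory.congr_hom (congr_arg (fun t => t.app U) (toSheafify_comp_map φ)) x

lemma sheafifyToPushforward_sheafifyApp {Z : Scheme.{u}} (f : Z ⟶ Y)
    {P : Y.Etaleᵒᵖ ⥤ AddCommGrpCat.{u}}
    {Q : Z.Etaleᵒᵖ ⥤ AddCommGrpCat.{u}} (φ : P ⟶ (etalePullback f).op ⋙ Q)
    (U : Y.Etale) (x : P.obj (op U)) :
    (sheafifyToPushforward f φ).hom.app (op U) (sheafifyApp P (op U) x) =
      sheafifyApp Q (op ((etalePullback f).obj U)) (φ.app (op U) x) :=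
  ConcreteCategory.congr_hom
    (congr_arg (fun t => t.app (op U)) (toSheafify_comp_sheafifyToPushforward f φ)) x

end Sheaves

namespace LogStructure

variable {Y : Scheme.{u}} {L : LogStructure Y}

/-- Equality in the associated sheaf holds locally in the presheaf `ℳ(V)^gp`, where integrality
gives local equality in `ℳ`; as `ℳ` is a sheaf, this is equality. -/
lemma IsFS.eq_of_sheafifyApp_toGp_eq (hL : L.IsFS) {U : Y.Etale} {m n : L.sheaf.obj.obj (op U)}
    (h : sheafifyApp L.gpPresheaf (op U) (L.toGp m) = sheafifyApp L.gpPresheaf (op U) (L.toGp n)) :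
    m = n := by
  obtain ⟨S, hS, H⟩ := exists_cover_of_sheafifyApp_eq _ _ h
  refine L.ext_of_cover hS fun V r hr => hL.toGp_injective _ ?_
  rw [← gpPresheaf_map_toGp, ← gpPresheaf_map_toGp, H V r hr]

end LogStructure

/-! ### The square of sheaves attached to a strict closed immersion -/

namespace LogScheme.Hom

variable {Z Y : LogScheme.{u}} {i : LogScheme.Hom Z Y}

/-- The map `ℳ_Y^gp ⟶ i_* ℳ_Z^gp` of presheaves. -/
abbrev gpPresheafMap (i : LogScheme.Hom Z Y) :
    Y.log.gpPresheaf ⟶ (etalePullback i.base).op ⋙ Z.log.gpPresheaf :=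
  Functor.whiskerRight i.flat (groupCompletion ⋙ CommGrpCat.toAddCommGrp)

lemma gpPresheafMap_toGp (i : LogScheme.Hom Z Y) {U : Y.scheme.Etale}
    (m : Y.log.sheaf.obj.obj (op U)) :
    i.gpPresheafMap.app (op U) (Y.log.toGp m) = Z.log.toGp (i.onSections U m) :=
  congr_arg Additive.ofMul (DFunLike.congr_fun (gpMap_comp_of (i.onSections U)) m)

lemma IsStrict.isLocallySurjective_gpPresheafMap (hi : i.IsStrict) [IsClosedImmersion i.base] :
    Presheaf.IsLocallySurjective Y.scheme.smallEtaleTopology i.gpPresheafMap := by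
  refine ⟨fun {U} s => ?_⟩
  obtain ⟨m, n, rfl⟩ := Z.log.exists_eq_sub s
  obtain ⟨S, hS, hm⟩ := hi.exists_onSections_eq U m
  obtain ⟨T, hT, hn⟩ := hi.exists_onSections_eq U n
  refine Y.scheme.smallEtaleTopology.superset_covering (fun V r hr => ?_)
    (Y.scheme.smallEtaleTopology.intersection_covering hS hT)
  obtain ⟨m', hm'⟩ := hm V r hr.1
  obtain ⟨n', hn'⟩ := hn V r hr.2
  refine ⟨Y.log.toGp m' - Y.log.toGp n', ?_⟩
  refine (map_sub (i.gpPresheafMap.app (op V)).hom _ _).trans ?_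
  refine Eq.trans ?_ (map_sub
    (Z.log.gpPresheaf.map ((etalePullback i.base).map r).op).hom _ _).symm
  refine congr_arg₂ (· - ·) ?_ ?_
  · refine (gpPresheafMap_toGp i m').trans ?_
    rw [hm']
    exact (Z.log.gpPresheaf_map_toGp _ m).symm
  · refine (gpPresheafMap_toGp i n').trans ?_
    rw [hn']
    exact (Z.log.gpPresheaf_map_toGp _ n).symm

lemma IsStrict.epi_gpSheafMap (hi : i.IsStrict) [IsClosedImmersion i.base] : Epi i.gpSheafMap := by
  have := hi.isLocallySurjective_gpPresheafMap
  exact epi_sheafifyToPushforward i.base i.gpPresheafMap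

lemma unitsSheafMap_comp (i : LogScheme.Hom Z Y) :
    unitsSheafMap i.base ≫ (pushforward i.base).map Z.log.unitsToGp =
      Y.log.unitsToGp ≫ i.gpSheafMap := by
  apply etaleSheafify_hom_ext
  ext U x
  change (((pushforward i.base).map Z.log.unitsToGp).hom.app U)
      ((unitsSheafMap i.base).hom.app U (sheafifyApp _ U x)) =
    i.gpSheafMap.hom.app U (Y.log.unitsToGp.hom.app U (sheafifyApp _ U x))
  refine (congr_arg _ (sheafifyToPushforward_sheafifyApp i.base _ U.unop x)).trans ?_
  refine (etaleSheafify_map_sheafifyApp _ _ _).trans ?_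
  refine Eq.trans ?_ (congr_arg _ (etaleSheafify_map_sheafifyApp _ U x)).symm
  refine Eq.trans ?_ (sheafifyToPushforward_sheafifyApp i.base _ U.unop _).symm
  refine congr_arg _ ?_
  refine Eq.trans ?_ (gpPresheafMap_toGp i (Y.log.unit U x)).symm
  exact congr_arg Z.log.toGp (i.onSections_unit U.unop x).symm

/-- Locally `g` is a difference of classes of `m` and `n`. Integrality of `ℳ_Z` turns the vanishing
of its image into an equality in `ℳ_Z`, to which `exists_unit_mul_eq` applies. -/
lemma IsStrict.exists_unitsToGp_eq (hi : i.IsStrict) [IsClosedImmersion i.base] (hZ : Z.log.IsFS)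
    (htriv : Y.log.IsTrivialOn (Set.range i.base)ᶜ) (U : Y.scheme.Etale)
    (g : Y.log.gpSheaf.obj.obj (op U)) (hg : i.gpSheafMap.hom.app (op U) g = 0) :
    ∃ S ∈ Y.scheme.smallEtaleTopology U, ∀ (V : Y.scheme.Etale) (r : V ⟶ U), S r →
      ∃ x, Y.log.unitsToGp.hom.app (op V) x = Y.log.gpSheaf.obj.map r.op g := by
  refine ⟨⟨fun V r => ∃ x, Y.log.unitsToGp.hom.app (op V) x = Y.log.gpSheaf.obj.map r.op g, ?_⟩,
    ?_, fun V r h => h⟩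
  · rintro V W r ⟨x, hx⟩ s
    refine ⟨(unitsSheaf Y.scheme).obj.map s.op x, ?_⟩
    refine (NatTrans.naturality_apply Y.log.unitsToGp.hom s.op x).trans ?_
    rw [hx, op_comp, Functor.map_comp]
    rfl
  obtain ⟨S, hS, H⟩ := exists_sheafifyApp_eq Y.log.gpPresheaf U g
  refine Y.scheme.smallEtaleTopology.transitive hS _ fun V r hr => ?_
  obtain ⟨x, hx⟩ := H V r hr
  obtain ⟨m, n, rfl⟩ := Y.log.exists_eq_sub x
  have key : sheafifyApp Z.log.gpPresheaf _ (Z.log.toGp (i.onSections V m)) =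
      sheafifyApp Z.log.gpPresheaf _ (Z.log.toGp (i.onSections V n)) := by
    rw [← sub_eq_zero, ← map_sub]
    have e : i.gpPresheafMap.app (op V) (Y.log.toGp m - Y.log.toGp n) =
        Z.log.toGp (i.onSections V m) - Z.log.toGp (i.onSections V n) := by
      refine (map_sub (i.gpPresheafMap.app (op V)).hom _ _).trans ?_
      exact congr_arg₂ (· - ·) (gpPresheafMap_toGp i m) (gpPresheafMap_toGp i n)
    refine (congr_arg _ e.symm).trans ?_
    refine (sheafifyToPushforward_sheafifyApp i.base i.gpPresheafMap V _).symm.trans ?_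
    rw [hx]
    refine (NatTrans.naturality_apply i.gpSheafMap.hom r.op g).trans ?_
    rw [hg]
    exact map_zero (((pushforward i.base).obj Z.log.gpSheaf).obj.map r.op).hom
  obtain ⟨T, hT, HT⟩ := hi.exists_unit_mul_eq htriv (hZ.eq_of_sheafifyApp_toGp_eq key)
  refine Y.scheme.smallEtaleTopology.superset_covering (fun W s hs => ?_) hT
  obtain ⟨t, ht⟩ := HT W s hs
  refine ⟨sheafifyApp (unitsPresheaf Y.scheme) (op W) (Additive.ofMul t), ?_⟩
  refine (etaleSheafify_map_sheafifyApp _ _ _).trans ?_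
  have e : Y.log.gpPresheaf.map s.op (Y.log.toGp m - Y.log.toGp n) =
      Y.log.toGp (Y.log.unit (op W) t) := by
    refine (map_sub (Y.log.gpPresheaf.map s.op).hom _ _).trans ?_
    refine (congr_arg₂ (· - ·) (Y.log.gpPresheaf_map_toGp _ m)
      (Y.log.gpPresheaf_map_toGp _ n)).trans ?_
    rw [ht, LogStructure.toGp_mul, add_sub_cancel_right]
  refine (congr_arg (sheafifyApp Y.log.gpPresheaf (op W)) e.symm).trans ?_
  rw [sheafifyApp_map, hx, op_comp, Functor.map_comp]
  rfl

end LogScheme.Hom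

end LogGeometry

open LogGeometry in
theorem proposition5p3 (Z Y : LogScheme.{u}) (hZ : Z.log.IsFS) (hY : Y.log.IsFS)
    (i : LogScheme.Hom Z Y) (hi : i.IsStrictClosedImmersion)
    (htriv : Y.log.IsTrivialOn (Set.range i.base)ᶜ) :
    Nonempty i.PicardSquare ∧ ∀ S : i.PicardSquare, S.IsCartesian := by
  have := hi.isClosedImmersion
  have := hi.isStrict.epi_gpSheafMap
  have := hY.mono_unitsToGp
  have := hZ.mono_unitsToGp
  have comm := i.unitsSheafMap_comp
  have := isIso_kernel_map_of_locally _ _ _ _ comm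
    (hi.isStrict.exists_unitsToGp_eq hZ htriv)
  exact ⟨RGammaSquare.nonempty_of_comm comm, fun S => S.isCartesian_of_isIso_kernel comm⟩
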